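/- \textbf{Vertex Sampling Lemma.} \emph{Setting.} $H=(V,E)$ is a finite hypergraph (parallel hyperedges allowed) with $|V|=n$, at most $m$ hyperedges, and every hyperedge of cardinality between $r$ and $2r$, where $r\ge 1$. The multi-graph $\Phi(H)$ of a hypergraph is obtained by replacing each hyperedge by a clique of unit-weight edges on its vertices; each multi-edge belongs to one hyperedge. For a multi-graph $G$, $R^{G}(u,v)$ is the effective resistance between $u$ and $v$. A hyperedge $e$ \emph{spans} a vector $x\in[0,1]^V$ if there are $u,v\in e$ with $x[u]=1$ and $x[v]=0$. The \emph{collective energy} of $x_1,\dots,x_k\in[0,1]^V$ is \[ \mathcal E^H(x_1,\dots,x_k)=\sum_{e\in E}\max_{u,v\in e}\sum_{i=1}^k (x_i[u]-x_i[v])^2 . \] \emph{The algorithm} $\mathtt{VS}(H,\lambda)$ \emph{with} $T$ \emph{rounds}, where $\lambda\ge1$. Start with $F'=\emptyset$ and repeat $T$ times: keep each vertex independently with probability $1/r$, let $V'$ be the set of kept vertices, and let $G'$ be the multi-graph of the hypergraph formed by the sets $e\cap V'$, one for each hyperedge $e$ not yet deleted; sample each multi-edge $(u,v)$ of $G'$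 independently with probability $\min\{1,\lambda R^{G'}(u,v)\}$; add to $F'$, and delete from $H$, all hyperedges to which at least one sampled multi-edge belongs. The output is $F'$. \emph{Statement.} For all constants $A\in\mathbb R$, $P>0$ and $a,p,d\in\mathbb N$ there are constants $B,C\ge 1$ and $b,c\in\mathbb N$, depending only on $A,a,P,p,d$, such that the following holds. Let $H$ be as above, let $F\subseteq E$, let $\theta\in(0,1)$ with $\theta\ge 1/(P n^{p})$, let $k\ge1$ and $x_1,\dots,x_k\in[0,1]^V$ be such that \begin{enumerate} \item each $x_i$ is spanned by at least one hyperedge in $F$; \item $\mathcal E^H(x_1,\dots,x_k)\le k\cdot A\,(1+\log(nm))^{a}/\theta$. \end{enumerate} Then there is a (deterministic) hyperedge $f\in F$ that spans at least one $x_i$ and satisfies \[ \Pr\bigl[f\in \mathtt{VS}\bigl(H,\ \theta^{-1}B(1+\log(nm))^{b}\bigr)\bigr]\ \ge\ 1-\frac1{(nm)^{d}}, \] where $\mathtt{VS}$ is run for $r\cdot\lceil C(1+\log(nm))^{c}\rceil$ rounds. -/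

import Mathlib

open scoped ENNReal

noncomputable section

/-- A finite hypergraph on the vertices `0, …, n - 1` with `M` hyperedges indexed by `Fin M`.
Parallel hyperedges (different indices with the same vertex set) are allowed. -/
structure FinHypergraph (n M : ℕ) where
  edge : Fin M → Finset (Fin n)

/-- A finite multi-graph on `Fin n` whose multi-edges carry labels in `Fin M`: the triple
`(e, u, v)` is a multi-edge with label `e` between `u` and `v`. -/
abbrev LabelledMultigraph (n M : ℕ) := Finset (Fin M × Fin n × Fin n)

namespace FinHypergraph

variable {n M : ℕ}

/-- Keep only the vertices in `U`: every hyperedge `e` is replaced by `e ∩ U`. -/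
def restrict (H : FinHypergraph n M) (U : Finset (Fin n)) : FinHypergraph n M :=
  ⟨fun e => H.edge e ∩ U⟩

/-- The multi-graph of the hypergraph formed by the hyperedges of `H` with index in `S`: each of
these hyperedges is replaced by a clique, and each multi-edge remembers its hyperedge. The
unordered pair `{u, v}` is represented once, with `u < v`. -/
def multigraph (H : FinHypergraph n M) (S : Finset (Fin M)) : LabelledMultigraph n M :=
  Finset.univ.filter fun t =>
    t.1 ∈ S ∧ t.2.1 ∈ H.edge t.1 ∧ t.2.2 ∈ H.edge t.1 ∧ t.2.1 < t.2.2

/-- The hyperedge `e` spans the potential vector `x`. -/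
def Spans (H : FinHypergraph n M) (e : Fin M) (x : Fin n → ℝ) : Prop :=
  ∃ u ∈ H.edge e, ∃ v ∈ H.edge e, x u = 1 ∧ x v = 0

/-- The collective energy of `x 0, …, x (k - 1)`; the supremum is a maximum over the finitely many
pairs of vertices of the hyperedge (and is `0` for an empty hyperedge). -/
def collectiveEnergy (H : FinHypergraph n M) {k : ℕ} (x : Fin k → Fin n → ℝ) : ℝ :=
  ∑ e : Fin M, ⨆ p : {a // a ∈ H.edge e} × {a // a ∈ H.edge e},
    ∑ i : Fin k, (x i p.1 - x i p.2) ^ 2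

end FinHypergraph

namespace LabelledMultigraph

variable {n M : ℕ}

/-- The Laplacian of the multi-graph (every multi-edge has unit conductance), applied to `φ`. -/
def laplacian (G : LabelledMultigraph n M) (φ : Fin n → ℝ) : Fin n → ℝ :=
  ∑ t ∈ G, (φ t.2.1 - φ t.2.2) • (Pi.single t.2.1 1 - Pi.single t.2.2 1 : Fin n → ℝ)

/-- `φ` is the vector of electrical potentials when a unit current enters at `u` and leaves
at `v`. -/
def IsUnitCurrentPotential (G : LabelledMultigraph n M) (u v : Fin n) (φ : Fin n → ℝ) : Prop :=
  G.laplacian φ = Pi.single u 1 - Pi.single v 1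

/-- The effective resistance between `u` and `v`: the potential difference between `u` and `v` when
a unit current is sent from `u` to `v`. It does not depend on the choice of the potentials (see
`effResistance_eq`), and it is `∞` if no such potentials exist, that is, if `u` and `v` are in
different components. -/
def effResistance (G : LabelledMultigraph n M) (u v : Fin n) : ℝ≥0∞ :=
  ⨅ (φ : Fin n → ℝ) (_ : G.IsUnitCurrentPotential u v φ), ENNReal.ofReal (φ u - φ v)

theorem laplacian_symm (G : LabelledMultigraph n M) (φ ψ : Fin n → ℝ) :
    ψ ⬝ᵥ G.laplacian φ = φ ⬝ᵥ G.laplacian ψ := by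
  simp only [laplacian, dotProduct_sum, dotProduct_smul, dotProduct_sub, dotProduct_single,
    mul_one, smul_eq_mul]
  exact Finset.sum_congr rfl fun t _ => mul_comm _ _

theorem effResistance_eq (G : LabelledMultigraph n M) {u v : Fin n} {φ : Fin n → ℝ}
    (h : G.IsUnitCurrentPotential u v φ) :
    G.effResistance u v = ENNReal.ofReal (φ u - φ v) := by
  refine le_antisymm (iInf₂_le φ h) (le_iInf₂ fun ψ hψ => le_of_eq ?_)
  have key := G.laplacian_symm φ ψ
  rw [show G.laplacian φ = _ from h, show G.laplacian ψ = _ from hψ] at key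
  simp only [dotProduct_sub, dotProduct_single, mul_one] at key
  rw [key]

end LabelledMultigraph

/-- The random subset of the finite set `s` that contains each `a ∈ s` independently with
probability `min 1 (p a)`. -/
def independentSubset {α : Type*} [DecidableEq α] (s : Finset α) (p : α → ℝ≥0∞) :
    PMF (Finset α) :=
  PMF.ofFinset
    (fun T => if T ⊆ s then (∏ a ∈ T, min 1 (p a)) * ∏ a ∈ s \ T, (1 - min 1 (p a)) else 0)
    s.powerset
    (by
      rw [Finset.sum_congr rfl fun T hT => if_pos (Finset.mem_powerset.1 hT),
        ← Finset.prod_add]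
      exact Finset.prod_eq_one fun a _ => add_tsub_cancel_of_le (min_le_left _ _))
    (fun _ hT => if_neg fun h => hT (Finset.mem_powerset.2 h))

namespace FinHypergraph

variable {n M : ℕ}

/-- One round of the vertex sampling algorithm, when the hyperedges in `F` have been recovered (and
deleted) so far. Keep each vertex independently with probability `1 / r`; in the multi-graph `G` of
the resulting hypergraph, sample each multi-edge `(u, v)` independently with probability
`min 1 (lam * R(u, v))`, where `R` is the effective resistance in `G`; recover the hyperedges to
which the sampled multi-edges belong. -/
def vsRound (H : FinHypergraph n M) (r : ℕ) (lam : ℝ) (F : Finset (Fin M)) :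
    PMF (Finset (Fin M)) :=
  (independentSubset Finset.univ fun _ : Fin n => (r : ℝ≥0∞)⁻¹).bind fun U =>
    let G : LabelledMultigraph n M := (H.restrict U).multigraph Fᶜ
    (independentSubset G fun t => ENNReal.ofReal lam * G.effResistance t.2.1 t.2.2).bind fun T =>
      PMF.pure (F ∪ T.image Prod.fst)

/-- The law of the set of hyperedges recovered by `rounds` rounds of vertex sampling at rate `1 / r`
with oversampling rate `lam`. -/
def vs (H : FinHypergraph n M) (r : ℕ) (lam : ℝ) (rounds : ℕ) : PMF (Finset (Fin M)) :=
  Nat.rec (PMF.pure ∅) (fun _ law => law.bind (H.vsRound r lam)) rounds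

end FinHypergraph

/-- The polylogarithmic bound `C (1 + log (n m)) ^ c`. -/
def polylog (C : ℝ) (c n m : ℕ) : ℝ :=
  C * (1 + Real.log (n * m)) ^ c

end

/-!
The theorem holds because a hyperedge that is hard to recover forces other hyperedges to be
recovered, and the collective energy bounds how often that can happen.

Choose for each `i` a hyperedge `f i ∈ F` spanning `x i`. After possibly replacing `x i` by
`1 - x i`, there is a vector `z i` with the same potential differences and an anchor `v i ∈ f i` with
`z i (v i) = 1` such that at least `r / 2` vertices of `f i` have potential at most `1 / 2`
(`FinHypergraph.Spans.exists_anchor`). The anchor is kept with probability `1 / r`. Independently of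
that, the other kept vertices form, with constant probability for an average `i`, a good set: they
contain a vertex of `f i` with low potential, they induce little energy of `z i`, and they meet each
hyperedge in `O(1 + log (n m))` vertices (`FinHypergraph.le_goodProb`). The collective energy enters
here: it bounds the sum over `i` of the expected induced energies, since the two ends of a given pair
are both kept with probability `1 / r ^ 2`.

When the anchor and a good set are kept, truncate `z i` to `[1/2, 3/4]` and let `s` be the energy of
the truncated vector on the multi-edges at the anchor. By Dirichlet's principle the resistance of a
multi-edge is at least its squared potential difference divided by `s` plus a small term. If `s` is
small compared with the oversampling rate `lam`, then `f i` is recovered for sure. Otherwise at least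
`lam / 2` multi-edges at the anchor are sampled in expectation, and because of the truncation `z i`
drops by at least `1/4` along all of them (`LabelledMultigraph.sampleProb_eq_one_or_le_sum`). The
squared drops along one pair of vertices, summed over `i`, are at most the energy of the hyperedge, so
recovering these hyperedges uses up collective energy
(`FinHypergraph.card_le_recoverProb_add_energy`). Hence the number of unrecovered `f i` plus a
multiple of the unrecovered energy (`FinHypergraph.progress`) decreases in expectation in every round
(`FinHypergraph.mean_vsRound_progress_le`). It cannot become negative, so some `f i` is recovered
within `20 r` rounds with probability at least `1 / 2` (`FinHypergraph.exists_missProb_le_half`).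

Repetition makes the failure probability small. By Rayleigh monotonicity, deleting hyperedges only
raises the resistances of the remaining multi-edges, so a coupling shows that the probability of
missing `f i` is antitone in the set of hyperedges already recovered
(`FinHypergraph.missProb_anti`), and therefore submultiplicative in the number of rounds
(`FinHypergraph.missProb_add_le`).
-/

/-! ### Expectations over finite probability spaces -/

namespace PMF

variable {α β : Type*} [Fintype α] [Fintype β]

/-- The expectation of a real function under a probability mass function on a finite type. -/
noncomputable def mean (μ : PMF β) (g : β → ℝ) : ℝ := ∑ b, (μ b).toReal * g b

theorem sum_toReal (μ : PMF β) : ∑ b, (μ b).toReal = 1 := by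
  rw [← ENNReal.toReal_sum fun b _ => μ.apply_ne_top b, ← tsum_fintype (L := .unconditional β),
    μ.tsum_coe, ENNReal.toReal_one]

theorem mean_const (μ : PMF β) (c : ℝ) : μ.mean (fun _ => c) = c := by
  rw [mean, ← Finset.sum_mul, sum_toReal, one_mul]

theorem mean_mono (μ : PMF β) {g h : β → ℝ} (H : ∀ b, g b ≤ h b) : μ.mean g ≤ μ.mean h :=
  Finset.sum_le_sum fun b _ => mul_le_mul_of_nonneg_left (H b) ENNReal.toReal_nonneg

theorem mean_nonneg (μ : PMF β) {g : β → ℝ} (H : ∀ b, 0 ≤ g b) : 0 ≤ μ.mean g :=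
  Finset.sum_nonneg fun b _ => mul_nonneg ENNReal.toReal_nonneg (H b)

theorem mean_add (μ : PMF β) (g h : β → ℝ) :
    μ.mean (fun b => g b + h b) = μ.mean g + μ.mean h := by
  simp only [mean, mul_add, Finset.sum_add_distrib]

theorem mean_sub (μ : PMF β) (g h : β → ℝ) :
    μ.mean (fun b => g b - h b) = μ.mean g - μ.mean h := by
  simp only [mean, mul_sub, Finset.sum_sub_distrib]

theorem mean_mul_left (μ : PMF β) (c : ℝ) (g : β → ℝ) :
    μ.mean (fun b => c * g b) = c * μ.mean g := by
  simp only [mean, Finset.mul_sum]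
  exact Finset.sum_congr rfl fun b _ => by ring

theorem mean_sum {ι : Type*} (μ : PMF β) (s : Finset ι) (g : ι → β → ℝ) :
    μ.mean (fun b => ∑ i ∈ s, g i b) = ∑ i ∈ s, μ.mean (g i) := by
  simp only [mean, Finset.mul_sum]
  exact Finset.sum_comm

theorem mean_pure (b : β) (g : β → ℝ) : (PMF.pure b).mean g = g b := by
  classical
  rw [mean, Finset.sum_eq_single b]
  · simp
  · intro c _ hc
    simp [PMF.pure_apply, hc]
  · simp

theorem mean_bind (μ : PMF α) (κ : α → PMF β) (g : β → ℝ) :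
    (μ.bind κ).mean g = μ.mean fun a => (κ a).mean g := by
  have h : ∀ b, ((μ.bind κ) b).toReal = ∑ a, (μ a).toReal * (κ a b).toReal := by
    intro b
    rw [PMF.bind_apply, tsum_fintype, ENNReal.toReal_sum]
    · exact Finset.sum_congr rfl fun a _ => ENNReal.toReal_mul
    · exact fun a _ => ENNReal.mul_ne_top (μ.apply_ne_top a) ((κ a).apply_ne_top b)
  simp only [mean, h, Finset.sum_mul, Finset.mul_sum, mul_assoc]
  exact Finset.sum_comm

theorem toReal_toOuterMeasure (μ : PMF β) (s : Set β) [DecidablePred (· ∈ s)] :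
    (μ.toOuterMeasure s).toReal = μ.mean fun b => if b ∈ s then 1 else 0 := by
  rw [PMF.toOuterMeasure_apply_fintype, ENNReal.toReal_sum]
  · refine Finset.sum_congr rfl fun b _ => ?_
    by_cases hb : b ∈ s <;> simp [hb]
  · intro b _
    by_cases hb : b ∈ s <;> simp [hb, μ.apply_ne_top]

/-- Markov's inequality. -/
theorem mean_gt_le (μ : PMF β) {g : β → ℝ} (hg : ∀ b, 0 ≤ g b) {c : ℝ} (hc : 0 < c)
    [DecidablePred fun b => c < g b] :
    μ.mean (fun b => if c < g b then 1 else 0) ≤ μ.mean g / c := by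
  rw [le_div_iff₀ hc, mul_comm, ← mean_mul_left]
  refine μ.mean_mono fun b => ?_
  split_ifs with h
  · linarith
  · simpa using hg b

end PMF

/-! ### Independent random subsets -/

section IndependentSubset

variable {α : Type*} [DecidableEq α] [Fintype α]

theorem toReal_min_one_mem (p : ℝ≥0∞) : 0 ≤ (min 1 p).toReal ∧ (min 1 p).toReal ≤ 1 :=
  ⟨ENNReal.toReal_nonneg, ENNReal.toReal_le_of_le_ofReal zero_le_one (by simp)⟩

theorem mean_independentSubset (s : Finset α) (p : α → ℝ≥0∞) (g : Finset α → ℝ) :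
    (independentSubset s p).mean g = ∑ T ∈ s.powerset,
      (∏ a ∈ T, (min 1 (p a)).toReal) * (∏ a ∈ s \ T, (1 - (min 1 (p a)).toReal)) * g T := by
  rw [PMF.mean, ← Finset.sum_subset (Finset.subset_univ s.powerset)]
  · refine Finset.sum_congr rfl fun T hT => ?_
    rw [independentSubset, PMF.ofFinset_apply, if_pos (Finset.mem_powerset.1 hT),
      ENNReal.toReal_mul, ENNReal.toReal_prod, ENNReal.toReal_prod]
    congr 2
    refine Finset.prod_congr rfl fun a _ => ?_
    rw [ENNReal.toReal_sub_of_le (min_le_left _ _) ENNReal.one_ne_top, ENNReal.toReal_one]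
  · intro T _ hT
    rw [independentSubset, PMF.ofFinset_apply, if_neg fun h => hT (Finset.mem_powerset.2 h),
      ENNReal.toReal_zero, zero_mul]

/-- Only subsets of `s` matter for an expectation over a random subset of `s`. -/
theorem mean_independentSubset_congr {s : Finset α} {p : α → ℝ≥0∞} {g h : Finset α → ℝ}
    (H : ∀ T ⊆ s, g T = h T) :
    (independentSubset s p).mean g = (independentSubset s p).mean h := by
  rw [mean_independentSubset, mean_independentSubset]
  exact Finset.sum_congr rfl fun T hT => by rw [H T (Finset.mem_powerset.1 hT)]

theorem mean_independentSubset_insert {s : Finset α} {a : α} (ha : a ∉ s) (p : α → ℝ≥0∞)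
    (g : Finset α → ℝ) :
    (independentSubset (insert a s) p).mean g =
      (min 1 (p a)).toReal * (independentSubset s p).mean (fun T => g (insert a T)) +
        (1 - (min 1 (p a)).toReal) * (independentSubset s p).mean g := by
  simp only [mean_independentSubset]
  rw [Finset.sum_powerset_insert ha, add_comm, Finset.mul_sum, Finset.mul_sum]
  congr 1
  · refine Finset.sum_congr rfl fun T hT => ?_
    have haT : a ∉ T := fun h => ha (Finset.mem_powerset.1 hT h)
    rw [Finset.prod_insert haT, Finset.insert_sdiff_insert, Finset.sdiff_insert_of_notMem ha]
    ring
  · refine Finset.sum_congr rfl fun T hT => ?_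
    have haT : a ∉ T := fun h => ha (Finset.mem_powerset.1 hT h)
    rw [Finset.insert_sdiff_of_notMem _ haT, Finset.prod_insert (by simp [ha])]
    ring

/-- Independence: the expectation of a product of functions of the individual indicators is the
product of their expectations. -/
theorem mean_independentSubset_prod (s : Finset α) (p : α → ℝ≥0∞) {W : Finset α} (hW : W ⊆ s)
    (b c : α → ℝ) :
    (independentSubset s p).mean (fun T => ∏ a ∈ W, if a ∈ T then b a else c a) =
      ∏ a ∈ W, ((min 1 (p a)).toReal * b a + (1 - (min 1 (p a)).toReal) * c a) := by
  induction s using Finset.induction_on generalizing W with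
  | empty =>
    obtain rfl := Finset.subset_empty.1 hW
    simp [PMF.mean_const]
  | insert v s hv ih =>
    rw [mean_independentSubset_insert hv]
    have h1 : ∀ T ⊆ s, (∏ a ∈ W.erase v, if a ∈ insert v T then b a else c a) =
        ∏ a ∈ W.erase v, if a ∈ T then b a else c a := fun T _ =>
      Finset.prod_congr rfl fun a ha => by simp [Finset.ne_of_mem_erase ha]
    have hWv : W.erase v ⊆ s := Finset.subset_insert_iff.1 hW
    by_cases hvW : v ∈ W
    · simp only [← Finset.mul_prod_erase W _ hvW, Finset.mem_insert_self, if_true]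
      have h2 : ∀ T ⊆ s, ((if v ∈ T then b v else c v) *
          ∏ a ∈ W.erase v, if a ∈ T then b a else c a) =
            c v * ∏ a ∈ W.erase v, if a ∈ T then b a else c a := fun T hT => by
        rw [if_neg fun h => hv (hT h)]
      rw [PMF.mean_mul_left, mean_independentSubset_congr h1, mean_independentSubset_congr h2,
        PMF.mean_mul_left, ih hWv]
      ring
    · rw [Finset.erase_eq_of_notMem hvW] at h1 hWv
      rw [mean_independentSubset_congr h1, ih hWv]
      ring

/-- The event `v ∈ T` is independent of `T \ {v}`. -/
theorem mean_independentSubset_mem_mul {s : Finset α} {v : α} (hv : v ∈ s) (p : α → ℝ≥0∞)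
    (h : Finset α → ℝ) :
    (independentSubset s p).mean (fun T => if v ∈ T then h (T.erase v) else 0) =
      (min 1 (p v)).toReal * (independentSubset s p).mean fun T => h (T.erase v) := by
  have hvs := Finset.notMem_erase v s
  rw [← Finset.insert_erase hv, mean_independentSubset_insert hvs,
    mean_independentSubset_insert hvs,
    mean_independentSubset_congr (g := fun T => if v ∈ T then h (T.erase v) else 0)
      (h := fun _ => 0) fun T hT => if_neg fun h => hvs (hT h),
    mean_independentSubset_congr (g := fun T => h ((insert v T).erase v))
      (h := fun T => h (T.erase v)) fun T _ => by rw [Finset.erase_insert_eq_erase]]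
  simp only [Finset.mem_insert_self, if_true, Finset.erase_insert_eq_erase, PMF.mean_const]
  ring

theorem mean_independentSubset_mem {s : Finset α} {v : α} (hv : v ∈ s) (p : α → ℝ≥0∞) :
    (independentSubset s p).mean (fun T => if v ∈ T then 1 else 0) = (min 1 (p v)).toReal := by
  rw [mean_independentSubset_mem_mul hv p fun _ => 1, PMF.mean_const, mul_one]

/-- Coupling: raising the inclusion probabilities decreases the expectation of an antitone function;
elements on which the function does not depend may have arbitrary probabilities. -/
theorem mean_independentSubset_anti (s : Finset α) {p p' : α → ℝ≥0∞} {g : Finset α → ℝ}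
    (hg : Antitone g) (hp : ∀ a ∈ s, p a ≤ p' a ∨ ∀ T, g (insert a T) = g T) :
    (independentSubset s p').mean g ≤ (independentSubset s p).mean g := by
  induction s using Finset.induction_on generalizing g with
  | empty => simp [mean_independentSubset]
  | insert v s hv ih =>
    rw [mean_independentSubset_insert hv, mean_independentSubset_insert hv]
    have hs : ∀ a ∈ s, p a ≤ p' a ∨ ∀ T, g (insert a T) = g T :=
      fun a ha => hp a (Finset.mem_insert_of_mem ha)
    have h1 := ih hg hs
    have h2 := ih (g := fun T => g (insert v T))
      (fun T T' h => hg (Finset.insert_subset_insert v h))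
      fun a ha => (hs a ha).imp_right fun h T => by rw [Finset.insert_comm, h]
    obtain ⟨hq0, hq1⟩ := toReal_min_one_mem (p' v)
    have h3 : (independentSubset s p).mean (fun T => g (insert v T)) ≤
        (independentSubset s p).mean g :=
      PMF.mean_mono _ fun T => hg (Finset.subset_insert v T)
    rcases hp v (Finset.mem_insert_self v s) with hle | heq
    · have h4 : (min 1 (p v)).toReal ≤ (min 1 (p' v)).toReal :=
        ENNReal.toReal_mono (by simp) (min_le_min_left _ hle)
      nlinarith
    · simp only [heq] at h2 ⊢
      nlinarith

theorem mean_independentSubset_extend {s s' : Finset α} (hs : s ⊆ s') (p : α → ℝ≥0∞)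
    (g : Finset α → ℝ) :
    (independentSubset s p).mean g =
      (independentSubset s' fun a => if a ∈ s then p a else 0).mean g := by
  rw [mean_independentSubset, mean_independentSubset]
  refine Finset.sum_subset_zero_on_sdiff (Finset.powerset_mono.2 hs) ?_ ?_
  · intro T hT
    simp only [Finset.mem_sdiff, Finset.mem_powerset, Finset.not_subset] at hT
    obtain ⟨-, a, haT, has⟩ := hT
    rw [Finset.prod_eq_zero haT (by simp [has])]
    simp
  · intro T hT
    have hT := Finset.mem_powerset.1 hT
    congr 2
    · exact Finset.prod_congr rfl fun a ha => by rw [if_pos (hT ha)]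
    · rw [← Finset.prod_subset (Finset.sdiff_subset_sdiff hs (le_refl T))]
      · exact Finset.prod_congr rfl fun a ha => by rw [if_pos (Finset.mem_sdiff.1 ha).1]
      · intro a ha ha'
        have : a ∉ s := fun h => ha' (Finset.mem_sdiff.2 ⟨h, (Finset.mem_sdiff.1 ha).2⟩)
        simp [this]

end IndependentSubset

/-! ### Effective resistances and energies -/

namespace LabelledMultigraph

variable {n M : ℕ}

/-- The energy of a vector of potentials: the sum over the multi-edges of the squared potential
difference. -/
def energy (G : LabelledMultigraph n M) (y : Fin n → ℝ) : ℝ :=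
  ∑ t ∈ G, (y t.2.1 - y t.2.2) ^ 2

theorem energy_nonneg (G : LabelledMultigraph n M) (y : Fin n → ℝ) : 0 ≤ G.energy y :=
  Finset.sum_nonneg fun _ _ => sq_nonneg _

theorem energy_mono {G G' : LabelledMultigraph n M} (h : G' ⊆ G) (y : Fin n → ℝ) :
    G'.energy y ≤ G.energy y :=
  Finset.sum_le_sum_of_subset_of_nonneg h fun _ _ _ => sq_nonneg _

theorem dotProduct_laplacian (G : LabelledMultigraph n M) (φ y : Fin n → ℝ) :
    y ⬝ᵥ G.laplacian φ = ∑ t ∈ G, (φ t.2.1 - φ t.2.2) * (y t.2.1 - y t.2.2) := by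
  simp only [laplacian, dotProduct_sum, dotProduct_smul, dotProduct_sub, dotProduct_single,
    mul_one, smul_eq_mul]

theorem IsUnitCurrentPotential.energy_eq {G : LabelledMultigraph n M} {u v : Fin n}
    {φ : Fin n → ℝ} (h : G.IsUnitCurrentPotential u v φ) : G.energy φ = φ u - φ v := by
  have := G.dotProduct_laplacian φ φ
  rw [show G.laplacian φ = _ from h] at this
  simp only [dotProduct_sub, dotProduct_single, mul_one] at this
  rw [this, energy]
  exact Finset.sum_congr rfl fun t _ => sq _

/-- Dirichlet's principle: the squared potential difference is at most the effective resistance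
times the energy. -/
theorem IsUnitCurrentPotential.sq_sub_le {G : LabelledMultigraph n M} {u v : Fin n}
    {φ : Fin n → ℝ} (h : G.IsUnitCurrentPotential u v φ) (y : Fin n → ℝ) :
    (y u - y v) ^ 2 ≤ (φ u - φ v) * G.energy y := by
  have := G.dotProduct_laplacian φ y
  rw [show G.laplacian φ = _ from h] at this
  simp only [dotProduct_sub, dotProduct_single, mul_one] at this
  rw [this, ← h.energy_eq]
  exact Finset.sum_mul_sq_le_sq_mul_sq _ _ _

theorem ofReal_sq_div_le_effResistance (G : LabelledMultigraph n M) (u v : Fin n) (y : Fin n → ℝ)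
    {D : ℝ} (hD : 0 < D) (hy : G.energy y ≤ D) :
    ENNReal.ofReal ((y u - y v) ^ 2 / D) ≤ G.effResistance u v := by
  refine le_iInf₂ fun φ hφ => ENNReal.ofReal_le_ofReal ?_
  rw [div_le_iff₀ hD]
  have h0 : 0 ≤ φ u - φ v := hφ.energy_eq ▸ G.energy_nonneg φ
  exact (hφ.sq_sub_le y).trans (mul_le_mul_of_nonneg_left hy h0)

theorem laplacian_add (G : LabelledMultigraph n M) (φ ψ : Fin n → ℝ) :
    G.laplacian (φ + ψ) = G.laplacian φ + G.laplacian ψ := by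
  simp only [laplacian, ← Finset.sum_add_distrib, ← add_smul, Pi.add_apply, add_sub_add_comm]

theorem laplacian_smul (G : LabelledMultigraph n M) (c : ℝ) (φ : Fin n → ℝ) :
    G.laplacian (c • φ) = c • G.laplacian φ := by
  simp only [laplacian, Finset.smul_sum, smul_smul, Pi.smul_apply, smul_eq_mul, mul_sub]

/-- The Laplacian as a linear operator on Euclidean space. -/
noncomputable def laplacianOp (G : LabelledMultigraph n M) :
    EuclideanSpace ℝ (Fin n) →ₗ[ℝ] EuclideanSpace ℝ (Fin n) where
  toFun φ := WithLp.toLp 2 (G.laplacian φ)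
  map_add' φ ψ := congrArg (WithLp.toLp 2) (G.laplacian_add φ ψ)
  map_smul' c φ := congrArg (WithLp.toLp 2) (G.laplacian_smul c φ)

theorem inner_laplacianOp (G : LabelledMultigraph n M) (φ y : EuclideanSpace ℝ (Fin n)) :
    inner ℝ (G.laplacianOp φ) y = (y : Fin n → ℝ) ⬝ᵥ G.laplacian φ := by
  rw [EuclideanSpace.inner_eq_star_dotProduct]
  rfl

theorem laplacianOp_isSymmetric (G : LabelledMultigraph n M) : G.laplacianOp.IsSymmetric := by
  intro φ y
  rw [real_inner_comm _ φ, inner_laplacianOp, inner_laplacianOp, laplacian_symm]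

/-- Adding multi-edges preserves the existence of potentials: the range of a Laplacian is the
orthogonal complement of its kernel, and the kernel shrinks. -/
theorem exists_isUnitCurrentPotential_of_subset {G G' : LabelledMultigraph n M} (hG : G' ⊆ G)
    {u v : Fin n} {φ : Fin n → ℝ} (h : G'.IsUnitCurrentPotential u v φ) :
    ∃ ψ, G.IsUnitCurrentPotential u v ψ := by
  have key : G'.laplacianOp (WithLp.toLp 2 φ) ∈ G.laplacianOp.range := by
    rw [← Submodule.orthogonal_orthogonal G.laplacianOp.range,
      G.laplacianOp_isSymmetric.orthogonal_range, Submodule.mem_orthogonal]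
    intro y hy
    have hy0 : G.energy y = 0 := by
      have h1 := G.inner_laplacianOp y y
      rw [LinearMap.mem_ker.1 hy, inner_zero_left, dotProduct_laplacian] at h1
      rw [energy, h1]
      exact Finset.sum_congr rfl fun t _ => sq _
    have h2 : ((y : Fin n → ℝ) u - (y : Fin n → ℝ) v) ^ 2 ≤ 0 := by
      have h3 := h.sq_sub_le y
      have h4 := energy_mono hG y
      rwa [le_antisymm (h4.trans_eq hy0) (G'.energy_nonneg y), mul_zero] at h3
    rw [real_inner_comm, inner_laplacianOp]
    change (y : Fin n → ℝ) ⬝ᵥ G'.laplacian φ = 0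
    rw [show G'.laplacian φ = _ from h]
    simp only [dotProduct_sub, dotProduct_single, mul_one]
    exact pow_eq_zero_iff (two_ne_zero) |>.1 (le_antisymm h2 (sq_nonneg _))
  obtain ⟨ψ, hψ⟩ := key
  refine ⟨ψ, ?_⟩
  have h5 : G.laplacian ψ = G'.laplacian φ := congrArg WithLp.ofLp hψ
  rw [IsUnitCurrentPotential, h5]
  exact h

/-- Rayleigh monotonicity: adding multi-edges does not increase effective resistances. -/
theorem effResistance_anti {G G' : LabelledMultigraph n M} (hG : G' ⊆ G) (u v : Fin n) :
    G.effResistance u v ≤ G'.effResistance u v := by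
  refine le_iInf₂ fun φ hφ => ?_
  obtain ⟨ψ, hψ⟩ := exists_isUnitCurrentPotential_of_subset hG hφ
  refine (iInf₂_le ψ hψ).trans (ENNReal.ofReal_le_ofReal ?_)
  have h1 := hφ.sq_sub_le ψ
  have h2 := energy_mono hG ψ
  rw [hψ.energy_eq] at h2
  have h3 : 0 ≤ φ u - φ v := hφ.energy_eq ▸ G'.energy_nonneg φ
  have h4 : 0 ≤ ψ u - ψ v := hψ.energy_eq ▸ G.energy_nonneg ψ
  nlinarith

end LabelledMultigraph

/-! ### Unrecovered hyperedges over several rounds -/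

namespace FinHypergraph

variable {n M : ℕ}

theorem mean_vsRound (H : FinHypergraph n M) (r : ℕ) (lam : ℝ) (D : Finset (Fin M))
    (g : Finset (Fin M) → ℝ) :
    (H.vsRound r lam D).mean g =
      (independentSubset Finset.univ fun _ : Fin n => (r : ℝ≥0∞)⁻¹).mean fun U =>
        (independentSubset ((H.restrict U).multigraph Dᶜ) fun t => ENNReal.ofReal lam *
          LabelledMultigraph.effResistance ((H.restrict U).multigraph Dᶜ) t.2.1 t.2.2).mean
            fun T => g (D ∪ T.image Prod.fst) := by
  simp only [vsRound, PMF.mean_bind, PMF.mean_pure]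

/-- The probability that the hyperedge `f` is not recovered within the given number of rounds when
the algorithm starts with the hyperedges in `D` already recovered. -/
noncomputable def missProb (H : FinHypergraph n M) (r : ℕ) (lam : ℝ) (f : Fin M) :
    ℕ → Finset (Fin M) → ℝ
  | 0, D => if f ∈ D then 0 else 1
  | t + 1, D => (H.vsRound r lam D).mean (H.missProb r lam f t)

theorem missProb_nonneg (H : FinHypergraph n M) (r : ℕ) (lam : ℝ) (f : Fin M) (t : ℕ)
    (D : Finset (Fin M)) : 0 ≤ H.missProb r lam f t D := by
  induction t generalizing D with
  | zero => rw [missProb]; split_ifs <;> norm_num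
  | succ t ih => exact PMF.mean_nonneg _ ih

theorem missProb_of_mem (H : FinHypergraph n M) (r : ℕ) (lam : ℝ) {f : Fin M} (t : ℕ)
    {D : Finset (Fin M)} (hf : f ∈ D) : H.missProb r lam f t D = 0 := by
  induction t generalizing D with
  | zero => rw [missProb, if_pos hf]
  | succ t ih =>
    rw [missProb, mean_vsRound]
    simp only [ih (Finset.mem_union_left _ hf), PMF.mean_const]

/-- Coupling of two rounds: with more hyperedges already recovered, all effective resistances are
larger, so that more of the remaining hyperedges are recovered. -/
theorem mean_vsRound_anti (H : FinHypergraph n M) (r : ℕ) (lam : ℝ) {g : Finset (Fin M) → ℝ}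
    (hg : Antitone g) : Antitone fun D => (H.vsRound r lam D).mean g := by
  intro D D' hD
  simp only [mean_vsRound]
  refine PMF.mean_mono _ fun U => ?_
  have hG : (H.restrict U).multigraph D'ᶜ ⊆ (H.restrict U).multigraph Dᶜ := by
    intro t ht
    simp only [multigraph, Finset.mem_filter, Finset.mem_compl] at ht ⊢
    exact ⟨ht.1, fun h => ht.2.1 (hD h), ht.2.2⟩
  rw [mean_independentSubset_extend hG]
  have hanti : Antitone fun T : LabelledMultigraph n M => g (D' ∪ T.image Prod.fst) :=
    fun T T' h => hg (Finset.union_subset_union_right (Finset.image_subset_image h))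
  refine (mean_independentSubset_anti _ hanti ?_).trans
    (PMF.mean_mono _ fun T => hg (Finset.union_subset_union_left hD))
  intro t ht
  by_cases h : t.1 ∈ D'
  · right
    intro T
    rw [Finset.image_insert, Finset.union_insert,
      Finset.insert_eq_of_mem (Finset.mem_union_left _ h)]
  · left
    have ht' : t ∈ (H.restrict U).multigraph D'ᶜ := by
      simp only [multigraph, Finset.mem_filter, Finset.mem_compl] at ht ⊢
      exact ⟨ht.1, h, ht.2.2⟩
    rw [if_pos ht']
    exact mul_le_mul_right (LabelledMultigraph.effResistance_anti hG _ _) _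

theorem missProb_anti (H : FinHypergraph n M) (r : ℕ) (lam : ℝ) (f : Fin M) (t : ℕ) :
    Antitone (H.missProb r lam f t) := by
  induction t with
  | zero =>
    intro D D' hD
    by_cases h : f ∈ D
    · simp [missProb, h, hD h]
    · simp only [missProb, h, if_false]
      split_ifs <;> norm_num
  | succ t ih => exact H.mean_vsRound_anti r lam ih

theorem mean_vs_missProb (H : FinHypergraph n M) (r : ℕ) (lam : ℝ) (f : Fin M) (s t : ℕ) :
    (H.vs r lam t).mean (H.missProb r lam f s) = H.missProb r lam f (s + t) ∅ := by
  induction t generalizing s with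
  | zero => exact PMF.mean_pure _ _
  | succ t ih =>
    rw [show H.vs r lam (t + 1) = (H.vs r lam t).bind (H.vsRound r lam) from rfl, PMF.mean_bind]
    exact (ih (s + 1)).trans (by rw [add_right_comm, add_assoc])

theorem mean_vs_notMem (H : FinHypergraph n M) (r : ℕ) (lam : ℝ) (f : Fin M) (t : ℕ) :
    (H.vs r lam t).mean (fun D => if f ∈ D then 0 else 1) = H.missProb r lam f t ∅ := by
  rw [← zero_add t, ← mean_vs_missProb, zero_add]
  rfl

theorem missProb_le_one (H : FinHypergraph n M) (r : ℕ) (lam : ℝ) (f : Fin M) (t : ℕ) :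
    H.missProb r lam f t ∅ ≤ 1 := by
  rw [← mean_vs_notMem]
  refine (PMF.mean_mono _ fun D => ?_).trans_eq (PMF.mean_const (H.vs r lam t) 1)
  split_ifs <;> norm_num

/-- Failures in successive blocks of rounds multiply, since a block that starts with recovered
hyperedges fails at most as often as one that starts afresh. -/
theorem missProb_add_le (H : FinHypergraph n M) (r : ℕ) (lam : ℝ) (f : Fin M) (s t : ℕ) :
    H.missProb r lam f (s + t) ∅ ≤ H.missProb r lam f s ∅ * H.missProb r lam f t ∅ := by
  rw [← mean_vs_missProb, ← mean_vs_notMem H r lam f t, ← PMF.mean_mul_left]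
  refine PMF.mean_mono _ fun D => ?_
  by_cases h : f ∈ D
  · simp [h, missProb_of_mem]
  · simpa [h] using H.missProb_anti r lam f s (Finset.empty_subset D)

theorem missProb_mono_rounds (H : FinHypergraph n M) (r : ℕ) (lam : ℝ) (f : Fin M) {s t : ℕ}
    (h : s ≤ t) : H.missProb r lam f t ∅ ≤ H.missProb r lam f s ∅ := by
  obtain ⟨u, rfl⟩ := Nat.exists_eq_add_of_le h
  exact (H.missProb_add_le r lam f s u).trans
    (mul_le_of_le_one_right (H.missProb_nonneg ..) (H.missProb_le_one ..))

theorem missProb_mul_le_pow (H : FinHypergraph n M) (r : ℕ) (lam : ℝ) (f : Fin M) (s j : ℕ) :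
    H.missProb r lam f (s * j) ∅ ≤ H.missProb r lam f s ∅ ^ j := by
  induction j with
  | zero => simpa using H.missProb_le_one r lam f 0
  | succ j ih =>
    rw [Nat.mul_succ, pow_succ]
    exact (H.missProb_add_le ..).trans
      (mul_le_mul_of_nonneg_right ih (H.missProb_nonneg ..))

theorem toReal_vs_mem (H : FinHypergraph n M) (r : ℕ) (lam : ℝ) (f : Fin M) (t : ℕ) :
    ((H.vs r lam t).toOuterMeasure {S | f ∈ S}).toReal = 1 - H.missProb r lam f t ∅ := by
  rw [PMF.toReal_toOuterMeasure, ← mean_vs_notMem, eq_sub_iff_add_eq, ← PMF.mean_add]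
  refine Eq.trans (congrArg _ (funext fun D => ?_)) (PMF.mean_const (H.vs r lam t) 1)
  by_cases h : f ∈ D <;> simp [h]

end FinHypergraph

/-! ### Recovery and energy loss for a fixed set of kept vertices -/

/-- Truncation of a potential to the interval `[1/2, 3/4]`. It keeps the gap between potential `1`
and potentials at most `1/2`, and hides the small gaps near `1`. -/
noncomputable def clampMid (a : ℝ) : ℝ := max (min a (3 / 4)) (1 / 2)

theorem sq_clampMid_sub_le (a b : ℝ) : (clampMid a - clampMid b) ^ 2 ≤ (a - b) ^ 2 := by
  refine sq_le_sq.2 ?_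
  unfold clampMid
  exact (abs_max_sub_max_le_abs _ _ _).trans (abs_inf_sub_inf_le_abs a b (3 / 4))

theorem clampMid_one : clampMid 1 = 3 / 4 := by norm_num [clampMid]

theorem clampMid_of_le {a : ℝ} (h : a ≤ 1 / 2) : clampMid a = 1 / 2 := by
  rw [clampMid, max_eq_right ((min_le_left _ _).trans h)]

theorem clampMid_of_ge {a : ℝ} (h : 3 / 4 ≤ a) : clampMid a = 3 / 4 := by
  rw [clampMid, min_eq_right h]; norm_num

theorem sq_clampMid_one_sub_le (a : ℝ) : (clampMid 1 - clampMid a) ^ 2 ≤ 1 / 16 := by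
  have h1 : 1 / 2 ≤ clampMid a := le_max_right _ _
  have h2 : clampMid a ≤ 3 / 4 := max_le (min_le_right _ _) (by norm_num)
  rw [clampMid_one]
  nlinarith

theorem one_sixteenth_le_of_clampMid_ne {a : ℝ} (h : clampMid 1 - clampMid a ≠ 0) :
    1 / 16 ≤ (1 - a) ^ 2 := by
  have h1 : a < 3 / 4 := lt_of_not_ge fun h' => h (by rw [clampMid_of_ge h', clampMid_one, sub_self])
  nlinarith

namespace LabelledMultigraph

variable {n M : ℕ}

/-- The multi-edges incident to the vertex `v`. -/
def star (G : LabelledMultigraph n M) (v : Fin n) : LabelledMultigraph n M :=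
  G.filter fun t => t.2.1 = v ∨ t.2.2 = v

/-- The multi-edges not incident to the vertex `v`. -/
def deleteVertex (G : LabelledMultigraph n M) (v : Fin n) : LabelledMultigraph n M :=
  G.filter fun t => ¬ (t.2.1 = v ∨ t.2.2 = v)

theorem energy_star_add_energy_deleteVertex (G : LabelledMultigraph n M) (v : Fin n)
    (y : Fin n → ℝ) : energy (G.star v) y + energy (G.deleteVertex v) y = G.energy y :=
  Finset.sum_filter_add_sum_filter_not _ _ _

/-- The probability with which the multi-edge `t` is sampled at oversampling rate `lam`. -/
noncomputable def sampleProb (G : LabelledMultigraph n M) (lam : ℝ) (t : Fin M × Fin n × Fin n) :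
    ℝ :=
  (min 1 (ENNReal.ofReal lam * G.effResistance t.2.1 t.2.2)).toReal

theorem min_one_le_sampleProb (G : LabelledMultigraph n M) {lam : ℝ} (hlam : 0 ≤ lam)
    (y : Fin n → ℝ) {D : ℝ} (hD : 0 < D) (hy : G.energy y ≤ D) (t : Fin M × Fin n × Fin n) :
    min 1 (lam * (y t.2.1 - y t.2.2) ^ 2 / D) ≤ G.sampleProb lam t := by
  have h0 : 0 ≤ lam * (y t.2.1 - y t.2.2) ^ 2 / D := by positivity
  have h1 : ENNReal.ofReal (min 1 (lam * (y t.2.1 - y t.2.2) ^ 2 / D)) ≤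
      min 1 (ENNReal.ofReal lam * G.effResistance t.2.1 t.2.2) := by
    rw [ENNReal.ofReal_min, ENNReal.ofReal_one, mul_div_assoc, ENNReal.ofReal_mul hlam]
    exact min_le_min_left _
      (mul_le_mul_right (G.ofReal_sq_div_le_effResistance _ _ y hD hy) _)
  have h2 := ENNReal.toReal_mono (by simp) h1
  rwa [ENNReal.toReal_ofReal (le_min zero_le_one h0)] at h2

theorem sampleProb_nonneg (G : LabelledMultigraph n M) (lam : ℝ) (t : Fin M × Fin n × Fin n) :
    0 ≤ G.sampleProb lam t := ENNReal.toReal_nonneg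

theorem sampleProb_le_one (G : LabelledMultigraph n M) (lam : ℝ) (t : Fin M × Fin n × Fin n) :
    G.sampleProb lam t ≤ 1 := (toReal_min_one_mem _).2

/-- The dichotomy behind the algorithm. Let `z` be `1` at `v` and have small energy away from `v`.
Either every multi-edge from `v` down to potential at most `1 / 2` is sampled for sure, or many
multi-edges at `v` along which `z` drops substantially are sampled in expectation. -/
theorem sampleProb_eq_one_or_le_sum (G : LabelledMultigraph n M) {v : Fin n} {z : Fin n → ℝ}
    (hv : z v = 1) {κ lam : ℝ} (hκ : 0 < κ) (hlam : 32 * κ ≤ lam)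
    (hrest : energy (G.deleteVertex v) z ≤ κ) :
    (∀ t ∈ G, (t.2.1 = v ∧ z t.2.2 ≤ 1 / 2 ∨ t.2.2 = v ∧ z t.2.1 ≤ 1 / 2) →
        G.sampleProb lam t = 1) ∨
      lam / 2 ≤ ∑ t ∈ (G.star v).filter fun t => 1 / 16 ≤ (z t.2.1 - z t.2.2) ^ 2,
        G.sampleProb lam t := by
  set y : Fin n → ℝ := fun w => clampMid (z w) with hy
  set s := energy (G.star v) y with hs
  have hs0 : 0 ≤ s := energy_nonneg _ _
  have hyrest : energy (G.deleteVertex v) y ≤ κ :=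
    (Finset.sum_le_sum fun t _ => sq_clampMid_sub_le _ _).trans hrest
  have hD : 0 < s + κ := by positivity
  have hen : G.energy y ≤ s + κ := by
    rw [← energy_star_add_energy_deleteVertex G v y]; linarith
  have hlam0 : 0 ≤ lam := by linarith
  have hq := G.min_one_le_sampleProb hlam0 y hD hen
  by_cases hc : s + κ ≤ lam / 16
  · left
    intro t _ htv
    have hsq : (y t.2.1 - y t.2.2) ^ 2 = 1 / 16 := by
      rcases htv with ⟨h1, h2⟩ | ⟨h1, h2⟩
      · simp only [hy, h1, hv, clampMid_one, clampMid_of_le h2]; norm_num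
      · simp only [hy, h1, hv, clampMid_one, clampMid_of_le h2]; norm_num
    refine le_antisymm (G.sampleProb_le_one lam t) ((le_min le_rfl ?_).trans (hq t))
    rw [hsq, le_div_iff₀ hD]
    linarith
  · right
    push Not at hc
    have hstar : ∀ t ∈ G.star v, (y t.2.1 - y t.2.2) ^ 2 ≤ 1 / 16 ∧
        ((y t.2.1 - y t.2.2) ^ 2 ≠ 0 → 1 / 16 ≤ (z t.2.1 - z t.2.2) ^ 2) := by
      intro t ht
      rcases (Finset.mem_filter.1 ht).2 with h1 | h1
      · simp only [hy, h1, hv]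
        exact ⟨sq_clampMid_one_sub_le _, fun h =>
          one_sixteenth_le_of_clampMid_ne (pow_ne_zero_iff two_ne_zero |>.1 h)⟩
      · simp only [hy, h1, hv, sub_sq_comm _ (clampMid 1), sub_sq_comm _ (1 : ℝ)]
        exact ⟨sq_clampMid_one_sub_le _, fun h =>
          one_sixteenth_le_of_clampMid_ne (pow_ne_zero_iff two_ne_zero |>.1 h)⟩
    calc lam / 2 ≤ lam * s / (s + κ) := by
          rw [div_le_div_iff₀ two_pos hD]
          nlinarith
      _ = ∑ t ∈ G.star v, lam * (y t.2.1 - y t.2.2) ^ 2 / (s + κ) := by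
          rw [hs, energy, Finset.mul_sum, Finset.sum_div]
      _ ≤ ∑ t ∈ G.star v, if 1 / 16 ≤ (z t.2.1 - z t.2.2) ^ 2 then G.sampleProb lam t else 0 := by
          refine Finset.sum_le_sum fun t ht => ?_
          obtain ⟨h1, h2⟩ := hstar t ht
          split_ifs with h3
          · refine le_trans (le_min ?_ le_rfl) (hq t)
            rw [div_le_one hD]
            nlinarith
          · rw [not_not.1 (mt h2 h3)]
            simp
      _ = _ := (Finset.sum_filter _ _).symm

/-- The probability that the hyperedge `e` is recovered, that is, that some multi-edge with label
`e` is sampled. -/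
noncomputable def recoverProb (G : LabelledMultigraph n M) (lam : ℝ) (e : Fin M) : ℝ :=
  (independentSubset G fun t => ENNReal.ofReal lam * G.effResistance t.2.1 t.2.2).mean
    fun T => if e ∈ T.image Prod.fst then 1 else 0

theorem recoverProb_nonneg (G : LabelledMultigraph n M) (lam : ℝ) (e : Fin M) :
    0 ≤ G.recoverProb lam e :=
  PMF.mean_nonneg _ fun _ => by split_ifs <;> norm_num

theorem sampleProb_le_recoverProb (G : LabelledMultigraph n M) (lam : ℝ)
    {t : Fin M × Fin n × Fin n} (ht : t ∈ G) : G.sampleProb lam t ≤ G.recoverProb lam t.1 := by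
  rw [sampleProb, ← mean_independentSubset_mem ht
    fun t => ENNReal.ofReal lam * G.effResistance t.2.1 t.2.2]
  refine PMF.mean_mono _ fun T => ?_
  by_cases h : t ∈ T
  · rw [if_pos h, if_pos (Finset.mem_image_of_mem _ h)]
  · rw [if_neg h]
    split_ifs <;> norm_num

end LabelledMultigraph

namespace FinHypergraph

variable {n M : ℕ}

theorem sum_multigraph_le (H : FinHypergraph n M) (S : Finset (Fin M)) {g : Fin M → ℝ}
    (hg : ∀ e, 0 ≤ g e) :
    ∑ t ∈ H.multigraph S, g t.1 ≤ ∑ e ∈ S, ((H.edge e).card : ℝ) ^ 2 * g e := by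
  have hmem : ∀ t ∈ H.multigraph S, t.1 ∈ S := fun t ht => (Finset.mem_filter.1 ht).2.1
  rw [← Finset.sum_fiberwise_of_maps_to hmem]
  refine Finset.sum_le_sum fun e _ => ?_
  rw [Finset.sum_congr rfl fun t ht => congrArg g (Finset.mem_filter.1 ht).2, Finset.sum_const,
    nsmul_eq_mul]
  refine mul_le_mul_of_nonneg_right ?_ (hg e)
  have : ((H.multigraph S).filter fun t => t.1 = e).card ≤ (H.edge e ×ˢ H.edge e).card := by
    refine Finset.card_le_card_of_injOn Prod.snd ?_ ?_
    · intro t ht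
      obtain ⟨h1, rfl⟩ := Finset.mem_filter.1 ht
      have h2 := (Finset.mem_filter.1 h1).2
      exact Finset.mem_coe.2 (Finset.mem_product.2 ⟨h2.2.1, h2.2.2.1⟩)
    · intro t ht t' ht' h
      exact Prod.ext ((Finset.mem_filter.1 ht).2.trans (Finset.mem_filter.1 ht').2.symm) h
  rw [Finset.card_product, ← sq] at this
  exact_mod_cast this

/-- In a round with kept vertices `U`, consider the indices `i ∈ J` whose anchor `v i` is kept
together with a vertex of `f i` of much smaller potential, and whose energy away from the anchor is
small. By the dichotomy, each of them is recovered for sure or pays for the recovery of hyperedge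
energy. -/
theorem card_le_recoverProb_add_energy (H : FinHypergraph n M) {k : ℕ} {z : Fin k → Fin n → ℝ}
    {v : Fin k → Fin n} {f : Fin k → Fin M} {E : Fin M → ℝ} (hE0 : ∀ e, 0 ≤ E e)
    (hE : ∀ e, ∀ u ∈ H.edge e, ∀ w ∈ H.edge e, ∑ i, (z i u - z i w) ^ 2 ≤ E e)
    {κ lam Q : ℝ} (hκ : 0 < κ) (hlam : 32 * κ ≤ lam) (hQ : 0 ≤ Q) (D : Finset (Fin M))
    (U : Finset (Fin n))
    {J : Finset (Fin k)} (hf : ∀ i ∈ J, f i ∉ D) (hz : ∀ i ∈ J, z i (v i) = 1)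
    (hv : ∀ i ∈ J, v i ∈ H.edge (f i) ∩ U)
    (hw : ∀ i ∈ J, ∃ w ∈ H.edge (f i) ∩ U, z i w ≤ 1 / 2)
    (hrest : ∀ i ∈ J, LabelledMultigraph.energy
      (((H.restrict U).multigraph Dᶜ).deleteVertex (v i)) (z i) ≤ κ)
    (hcard : J.Nonempty → ∀ e, ((H.edge e ∩ U).card : ℝ) ^ 2 ≤ Q) :
    (J.card : ℝ) ≤ ∑ i ∈ Finset.univ.filter (fun i => f i ∉ D),
        LabelledMultigraph.recoverProb ((H.restrict U).multigraph Dᶜ) lam (f i) +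
      32 * Q / lam * ∑ e ∈ Dᶜ,
        E e * LabelledMultigraph.recoverProb ((H.restrict U).multigraph Dᶜ) lam e := by
  classical
  set G : LabelledMultigraph n M := (H.restrict U).multigraph Dᶜ with hG
  have hlam0 : 0 < lam := by linarith
  have hrec : ∀ e, 0 ≤ E e * G.recoverProb lam e :=
    fun e => mul_nonneg (hE0 e) (G.recoverProb_nonneg lam e)
  set I : Finset (Fin k) := J.filter fun i => G.recoverProb lam (f i) < 1 with hI
  set st : Fin k → LabelledMultigraph n M := fun i =>
    (G.star (v i)).filter fun t => 1 / 16 ≤ (z i t.2.1 - z i t.2.2) ^ 2 with hst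
  have hstar : ∀ i ∈ I, lam / 2 ≤ ∑ t ∈ st i, G.sampleProb lam t := by
    intro i hi
    obtain ⟨hiJ, hlt⟩ := Finset.mem_filter.1 hi
    refine (G.sampleProb_eq_one_or_le_sum (hz i hiJ) hκ hlam (hrest i hiJ)).resolve_left
      fun hall => hlt.not_ge ?_
    obtain ⟨w, hwe, hwz⟩ := hw i hiJ
    have hne : w ≠ v i := by
      rintro rfl
      rw [hz i hiJ] at hwz
      norm_num at hwz
    have hfD := Finset.mem_compl.2 (hf i hiJ)
    rcases lt_or_gt_of_ne hne with h | h
    · have ht : (f i, w, v i) ∈ G :=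
        Finset.mem_filter.2 ⟨Finset.mem_univ _, hfD, hwe, hv i hiJ, h⟩
      rw [← hall _ ht (Or.inr ⟨rfl, hwz⟩)]
      exact G.sampleProb_le_recoverProb lam ht
    · have ht : (f i, v i, w) ∈ G :=
        Finset.mem_filter.2 ⟨Finset.mem_univ _, hfD, hv i hiJ, hwe, h⟩
      rw [← hall _ ht (Or.inl ⟨rfl, hwz⟩)]
      exact G.sampleProb_le_recoverProb lam ht
  -- A sampled multi-edge is charged by the indices whose potential drops along it; their number is
  -- controlled by the energy of its hyperedge.
  have hcharge : (I.card : ℝ) * (lam / 2) ≤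
      16 * Q * ∑ e ∈ Dᶜ, E e * G.recoverProb lam e := by
    rcases J.eq_empty_or_nonempty with hJ | hJ
    · rw [hI, hJ]
      simp only [Finset.filter_empty, Finset.card_empty, Nat.cast_zero, zero_mul]
      exact mul_nonneg (by positivity) (Finset.sum_nonneg fun e _ => hrec e)
    calc (I.card : ℝ) * (lam / 2) = ∑ i ∈ I, lam / 2 := by rw [Finset.sum_const, nsmul_eq_mul]
      _ ≤ ∑ i ∈ I, ∑ t ∈ st i, G.sampleProb lam t := Finset.sum_le_sum hstar
      _ ≤ ∑ i, ∑ t ∈ st i, G.sampleProb lam t :=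
          Finset.sum_le_sum_of_subset_of_nonneg (Finset.subset_univ _) fun i _ _ =>
            Finset.sum_nonneg fun t _ => G.sampleProb_nonneg lam t
      _ ≤ ∑ i, ∑ t ∈ G, 16 * ((z i t.2.1 - z i t.2.2) ^ 2 * G.recoverProb lam t.1) := by
          refine Finset.sum_le_sum fun i _ => ?_
          have hsub : st i ⊆ G := (Finset.filter_subset _ _).trans (Finset.filter_subset _ _)
          refine (Finset.sum_le_sum fun t ht => ?_).trans
            (Finset.sum_le_sum_of_subset_of_nonneg hsub fun t _ _ =>
              mul_nonneg (by norm_num) (mul_nonneg (sq_nonneg _) (G.recoverProb_nonneg lam t.1)))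
          have h1 := (Finset.mem_filter.1 ht).2
          have h2 := G.sampleProb_le_recoverProb lam (hsub ht)
          have h3 := G.recoverProb_nonneg lam t.1
          nlinarith
      _ = ∑ t ∈ G, 16 * ((∑ i, (z i t.2.1 - z i t.2.2) ^ 2) * G.recoverProb lam t.1) := by
          rw [Finset.sum_comm]
          simp only [Finset.sum_mul, Finset.mul_sum]
      _ ≤ ∑ t ∈ G, 16 * (E t.1 * G.recoverProb lam t.1) := by
          refine Finset.sum_le_sum fun t ht => ?_
          have ht' := (Finset.mem_filter.1 ht).2
          have h1 := hE t.1 _ (Finset.mem_inter.1 ht'.2.1).1 _ (Finset.mem_inter.1 ht'.2.2.1).1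
          have := mul_le_mul_of_nonneg_right h1 (G.recoverProb_nonneg lam t.1)
          linarith
      _ ≤ ∑ e ∈ Dᶜ, ((H.edge e ∩ U).card : ℝ) ^ 2 * (16 * (E e * G.recoverProb lam e)) :=
          (H.restrict U).sum_multigraph_le Dᶜ (g := fun e => 16 * (E e * G.recoverProb lam e))
            fun e => mul_nonneg (by norm_num) (hrec e)
      _ ≤ ∑ e ∈ Dᶜ, Q * (16 * (E e * G.recoverProb lam e)) :=
          Finset.sum_le_sum fun e _ => mul_le_mul_of_nonneg_right (hcard hJ e)
            (mul_nonneg (by norm_num) (hrec e))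
      _ = _ := by
          rw [Finset.mul_sum]
          exact Finset.sum_congr rfl fun e _ => by ring
  have hsure : ((J.filter fun i => ¬ G.recoverProb lam (f i) < 1).card : ℝ) ≤
      ∑ i ∈ Finset.univ.filter (fun i => f i ∉ D), G.recoverProb lam (f i) := by
    rw [Finset.card_eq_sum_ones, Nat.cast_sum]
    refine (Finset.sum_le_sum fun i hi => ?_).trans
      (Finset.sum_le_sum_of_subset_of_nonneg ?_ fun i _ _ => G.recoverProb_nonneg lam (f i))
    · simpa using (Finset.mem_filter.1 hi).2
    · exact fun i hi => Finset.mem_filter.2 ⟨Finset.mem_univ i, hf i (Finset.mem_filter.1 hi).1⟩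
  have hsplit := Finset.card_filter_add_card_filter_not (s := J)
    fun i => G.recoverProb lam (f i) < 1
  rw [← hsplit, Nat.cast_add, add_comm]
  refine add_le_add hsure ?_
  rw [div_mul_eq_mul_div, le_div_iff₀ hlam0]
  linarith

end FinHypergraph

/-! ### Good sets of kept vertices -/

namespace FinHypergraph

variable {n M : ℕ}

/-- The energy of `z` in the clique multi-graph induced on the vertices in `W`. -/
noncomputable def inducedEnergy (H : FinHypergraph n M) (W : Finset (Fin n)) (z : Fin n → ℝ) : ℝ :=
  LabelledMultigraph.energy ((H.restrict W).multigraph Finset.univ) z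

theorem inducedEnergy_eq_sum (H : FinHypergraph n M) (W : Finset (Fin n)) (z : Fin n → ℝ) :
    H.inducedEnergy W z = ∑ t ∈ H.multigraph Finset.univ,
      if t.2.1 ∈ W ∧ t.2.2 ∈ W then (z t.2.1 - z t.2.2) ^ 2 else 0 := by
  rw [← Finset.sum_filter, inducedEnergy, LabelledMultigraph.energy]
  refine Finset.sum_congr ?_ fun _ _ => rfl
  ext t
  simp only [multigraph, restrict, Finset.mem_filter, Finset.mem_univ, Finset.mem_inter, true_and]
  tauto

theorem inducedEnergy_nonneg (H : FinHypergraph n M) (W : Finset (Fin n)) (z : Fin n → ℝ) :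
    0 ≤ H.inducedEnergy W z := LabelledMultigraph.energy_nonneg _ _

theorem multigraph_restrict_mono (H : FinHypergraph n M) {W U : Finset (Fin n)} (h : W ⊆ U)
    (S : Finset (Fin M)) : (H.restrict W).multigraph S ⊆ (H.restrict U).multigraph S := by
  intro t ht
  simp only [multigraph, restrict, Finset.mem_filter, Finset.mem_inter] at ht ⊢
  exact ⟨ht.1, ht.2.1, ⟨ht.2.2.1.1, h ht.2.2.1.2⟩, ⟨ht.2.2.2.1.1, h ht.2.2.2.1.2⟩, ht.2.2.2.2⟩

theorem inducedEnergy_mono (H : FinHypergraph n M) {W U : Finset (Fin n)} (h : W ⊆ U)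
    (z : Fin n → ℝ) : H.inducedEnergy W z ≤ H.inducedEnergy U z :=
  LabelledMultigraph.energy_mono (H.multigraph_restrict_mono h _) z

theorem energy_deleteVertex_le_inducedEnergy (H : FinHypergraph n M) (U : Finset (Fin n))
    (S : Finset (Fin M)) (v : Fin n) (z : Fin n → ℝ) :
    LabelledMultigraph.energy (((H.restrict U).multigraph S).deleteVertex v) z ≤
      H.inducedEnergy (U.erase v) z := by
  refine LabelledMultigraph.energy_mono (fun t ht => ?_) z
  simp only [LabelledMultigraph.deleteVertex, multigraph, restrict, Finset.mem_filter,
    Finset.mem_univ, Finset.mem_inter, Finset.mem_erase, true_and] at ht ⊢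
  tauto

/-- The law of the set of kept vertices. -/
noncomputable abbrev keptLaw (n r : ℕ) : PMF (Finset (Fin n)) :=
  independentSubset Finset.univ fun _ : Fin n => (r : ℝ≥0∞)⁻¹

theorem toReal_min_one_inv_natCast {r : ℕ} (hr : 0 < r) :
    (min 1 (r : ℝ≥0∞)⁻¹).toReal = 1 / r := by
  have : (r : ℝ≥0∞)⁻¹ ≤ 1 := ENNReal.inv_le_one.2 (by exact_mod_cast hr)
  rw [min_eq_right this, ENNReal.toReal_inv, ENNReal.toReal_natCast, one_div]

theorem mean_keptLaw_inducedEnergy (H : FinHypergraph n M) {r : ℕ} (hr : 0 < r) (z : Fin n → ℝ) :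
    (keptLaw n r).mean (fun U => H.inducedEnergy U z) =
      LabelledMultigraph.energy (H.multigraph Finset.univ) z / (r : ℝ) ^ 2 := by
  simp only [inducedEnergy_eq_sum, PMF.mean_sum, LabelledMultigraph.energy, Finset.sum_div]
  refine Finset.sum_congr rfl fun t ht => ?_
  have hne : t.2.1 ≠ t.2.2 := (Finset.mem_filter.1 ht).2.2.2.2.ne
  have h := mean_independentSubset_prod Finset.univ (fun _ : Fin n => (r : ℝ≥0∞)⁻¹)
    (Finset.subset_univ {t.2.1, t.2.2}) (fun _ => 1) (fun _ => 0)
  simp only [Finset.prod_pair hne, toReal_min_one_inv_natCast hr] at h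
  have h2 : ∀ U : Finset (Fin n), (if t.2.1 ∈ U ∧ t.2.2 ∈ U then (z t.2.1 - z t.2.2) ^ 2 else 0) =
      (z t.2.1 - z t.2.2) ^ 2 * ((if t.2.1 ∈ U then 1 else 0) * if t.2.2 ∈ U then 1 else 0) := by
    intro U
    by_cases h3 : t.2.1 ∈ U <;> by_cases h4 : t.2.2 ∈ U <;> simp [h3, h4]
  simp only [h2, PMF.mean_mul_left, h]
  ring

theorem mean_keptLaw_disjoint_le {r : ℕ} (hr : 0 < r) {A : Finset (Fin n)}
    (hA : (r : ℝ) / 2 ≤ A.card) :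
    (keptLaw n r).mean (fun U => if Disjoint A U then 1 else 0) ≤ 5 / 8 := by
  have h := mean_independentSubset_prod Finset.univ (fun _ : Fin n => (r : ℝ≥0∞)⁻¹)
    (Finset.subset_univ A) (fun _ => 0) (fun _ => 1)
  have h2 : ∀ U : Finset (Fin n), (if Disjoint A U then (1 : ℝ) else 0) =
      ∏ a ∈ A, if a ∈ U then 0 else 1 := by
    intro U
    split_ifs with hd
    · exact (Finset.prod_eq_one fun a ha => if_neg (Finset.disjoint_left.1 hd ha)).symm
    · obtain ⟨a, ha, haU⟩ := Finset.not_disjoint_iff.1 hd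
      exact (Finset.prod_eq_zero (f := fun a => if a ∈ U then (0 : ℝ) else 1) ha (if_pos haU)).symm
  simp only [h2]
  rw [h]
  simp only [toReal_min_one_inv_natCast hr, mul_zero, zero_add, mul_one, Finset.prod_const]
  have hr' : (0 : ℝ) < r := by exact_mod_cast hr
  have hr1 : (1 : ℝ) ≤ r := by exact_mod_cast hr
  have h3 : 0 ≤ 1 - 1 / (r : ℝ) := by rw [sub_nonneg, div_le_one hr']; exact hr1
  have h4 : 1 - 1 / (r : ℝ) ≤ Real.exp (-(1 / r)) := by
    have := Real.add_one_le_exp (-(1 / (r : ℝ))); linarith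
  have h5 : 1 + 1 / 2 + (1 / 2 : ℝ) ^ 2 / 2 ≤ Real.exp (1 / 2) :=
    Real.quadratic_le_exp_of_nonneg (by norm_num)
  calc (1 - 1 / (r : ℝ)) ^ A.card ≤ Real.exp (-(1 / r)) ^ A.card := pow_le_pow_left₀ h3 h4 _
    _ = Real.exp (A.card * -(1 / r)) := (Real.exp_nat_mul _ _).symm
    _ ≤ Real.exp (-(1 / 2)) := by
        rw [Real.exp_le_exp, mul_neg, neg_le_neg_iff, mul_one_div, le_div_iff₀ hr']
        linarith
    _ ≤ 5 / 8 := by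
        rw [Real.exp_neg, inv_le_comm₀ (Real.exp_pos _) (by norm_num)]
        linarith

theorem mean_keptLaw_two_pow_le {r : ℕ} (hr : 0 < r) {A : Finset (Fin n)}
    (hA : A.card ≤ 2 * r) :
    (keptLaw n r).mean (fun U => (2 : ℝ) ^ (A ∩ U).card) ≤ 8 := by
  have h := mean_independentSubset_prod Finset.univ (fun _ : Fin n => (r : ℝ≥0∞)⁻¹)
    (Finset.subset_univ A) (fun _ => 2) (fun _ => 1)
  have h2 : ∀ U : Finset (Fin n), (2 : ℝ) ^ (A ∩ U).card = ∏ a ∈ A, if a ∈ U then 2 else 1 := by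
    intro U
    rw [Finset.prod_ite, Finset.prod_const, Finset.prod_const_one, mul_one,
      Finset.filter_mem_eq_inter]
  simp only [h2]
  rw [h]
  simp only [toReal_min_one_inv_natCast hr, Finset.prod_const]
  have hr' : (0 : ℝ) < r := by exact_mod_cast hr
  have hA' : (A.card : ℝ) ≤ 2 * r := by exact_mod_cast hA
  have h4 : 1 / (r : ℝ) * 2 + (1 - 1 / r) * 1 ≤ Real.exp (1 / r) := by
    have := Real.add_one_le_exp (1 / (r : ℝ)); linarith
  have h5 : 0 ≤ 1 / (r : ℝ) * 2 + (1 - 1 / r) * 1 := by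
    have : 0 < 1 / (r : ℝ) := by positivity
    linarith
  calc (1 / (r : ℝ) * 2 + (1 - 1 / r) * 1) ^ A.card ≤ Real.exp (1 / r) ^ A.card :=
        pow_le_pow_left₀ h5 h4 _
    _ = Real.exp (A.card * (1 / r)) := (Real.exp_nat_mul _ _).symm
    _ ≤ Real.exp (2 * 1) := by
        rw [Real.exp_le_exp, mul_one_div, div_le_iff₀ hr']
        linarith
    _ = Real.exp 1 ^ 2 := Real.exp_nat_mul 1 2
    _ ≤ 2.8 ^ 2 := pow_le_pow_left₀ (Real.exp_pos 1).le
        (Real.exp_one_lt_d9.le.trans (by norm_num)) 2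
    _ ≤ 8 := by norm_num

/-- A set `W` of kept vertices is good for the hyperedge `f` and the potential `z` if it contains a
vertex of `f` with potential at most `1 / 2`, the energy of `z` induced on `W` is at most `κ`, and no
hyperedge has many vertices in `W` (in the form of a bound on an exponential moment). -/
def Good (H : FinHypergraph n M) (m : ℕ) (κ : ℝ) (f : Fin M) (z : Fin n → ℝ)
    (W : Finset (Fin n)) : Prop :=
  (∃ w ∈ H.edge f ∩ W, z w ≤ 1 / 2) ∧ H.inducedEnergy W z ≤ κ ∧
    ∑ e, (2 : ℝ) ^ (H.edge e ∩ W).card ≤ 128 * m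

open Classical in
/-- The probability that the kept vertices other than `v` form a good set. -/
noncomputable def goodProb (H : FinHypergraph n M) (r m : ℕ) (κ : ℝ) (f : Fin M) (z : Fin n → ℝ)
    (v : Fin n) : ℝ :=
  (keptLaw n r).mean fun U => if H.Good m κ f z (U.erase v) then 1 else 0

open Classical in
theorem mean_keptLaw_mem_good (H : FinHypergraph n M) {r : ℕ} (hr : 0 < r) (m : ℕ) (κ : ℝ)
    (f : Fin M) (z : Fin n → ℝ) (v : Fin n) :
    (keptLaw n r).mean (fun U => if v ∈ U ∧ H.Good m κ f z (U.erase v) then 1 else 0) =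
      H.goodProb r m κ f z v / r := by
  have h := mean_independentSubset_mem_mul (Finset.mem_univ v)
    (fun _ : Fin n => (r : ℝ≥0∞)⁻¹) fun W => if H.Good m κ f z W then 1 else 0
  rw [toReal_min_one_inv_natCast hr] at h
  simp only [ite_and]
  rw [h, goodProb]
  ring

/-- The three conditions of a good set fail with probability at most `5/8` (no low vertex is kept),
`1/16` (a hyperedge keeps many vertices) and, by Markov's inequality, the expected induced energy
divided by `κ`. -/
theorem le_goodProb (H : FinHypergraph n M) {r m : ℕ} (hr : 0 < r) (hMm : M ≤ m) (hm : 0 < m)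
    (hcard : ∀ e, (H.edge e).card ≤ 2 * r) {κ : ℝ} (hκ : 0 < κ) {f : Fin M} {z : Fin n → ℝ}
    {v : Fin n} (hv : z v = 1)
    (hlow : (r : ℝ) / 2 ≤ ((H.edge f).filter fun w => z w ≤ 1 / 2).card) :
    5 / 16 - LabelledMultigraph.energy (H.multigraph Finset.univ) z / (r : ℝ) ^ 2 / κ ≤
      H.goodProb r m κ f z v := by
  classical
  set A := (H.edge f).filter fun w => z w ≤ 1 / 2 with hA
  have hm' : (0 : ℝ) < m := by exact_mod_cast hm
  have h1 := mean_keptLaw_disjoint_le hr hlow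
  have h2 := (keptLaw n r).mean_gt_le (fun U => H.inducedEnergy_nonneg U z) hκ
  rw [mean_keptLaw_inducedEnergy H hr] at h2
  have h3 := (keptLaw n r).mean_gt_le (g := fun U => ∑ e, (2 : ℝ) ^ (H.edge e ∩ U).card)
    (fun U => Finset.sum_nonneg fun e _ => by positivity) (c := 128 * (m : ℝ)) (by positivity)
  have h4 : (keptLaw n r).mean (fun U => ∑ e, (2 : ℝ) ^ (H.edge e ∩ U).card) / (128 * (m : ℝ)) ≤
      1 / 16 := by
    rw [PMF.mean_sum, div_le_iff₀ (by positivity)]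
    calc _ ≤ ∑ _e : Fin M, (8 : ℝ) := Finset.sum_le_sum fun e _ => mean_keptLaw_two_pow_le hr (hcard e)
      _ = M * 8 := by rw [Finset.sum_const, Finset.card_univ, Fintype.card_fin, nsmul_eq_mul]
      _ ≤ 1 / 16 * (128 * m) := by
          have : (M : ℝ) ≤ m := by exact_mod_cast hMm
          linarith
  have h5 : (keptLaw n r).mean (fun U => 1 - (if Disjoint A U then 1 else 0) -
      (if κ < H.inducedEnergy U z then 1 else 0) -
      (if 128 * (m : ℝ) < ∑ e, (2 : ℝ) ^ (H.edge e ∩ U).card then 1 else 0)) ≤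
        H.goodProb r m κ f z v := by
    refine PMF.mean_mono _ fun U => ?_
    have hnn : (0 : ℝ) ≤ if H.Good m κ f z (U.erase v) then 1 else 0 := by
      split_ifs <;> norm_num
    by_cases c1 : Disjoint A U
    · rw [if_pos c1]
      split_ifs <;> norm_num
    by_cases c2 : κ < H.inducedEnergy U z
    · rw [if_neg c1, if_pos c2]
      split_ifs <;> norm_num
    by_cases c3 : 128 * (m : ℝ) < ∑ e, (2 : ℝ) ^ (H.edge e ∩ U).card
    · rw [if_neg c1, if_neg c2, if_pos c3]
      split_ifs <;> norm_num
    · rw [if_neg c1, if_neg c2, if_neg c3, if_pos]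
      · norm_num
      obtain ⟨w, hwA, hwU⟩ := Finset.not_disjoint_iff.1 c1
      obtain ⟨hwf, hwz⟩ := Finset.mem_filter.1 hwA
      refine ⟨⟨w, Finset.mem_inter.2 ⟨hwf, Finset.mem_erase.2 ⟨?_, hwU⟩⟩, hwz⟩,
        (H.inducedEnergy_mono (Finset.erase_subset v U) z).trans (not_lt.1 c2),
        le_trans (Finset.sum_le_sum fun e _ => ?_) (not_lt.1 c3)⟩
      · rintro rfl
        rw [hv] at hwz
        norm_num at hwz
      · exact pow_le_pow_right₀ one_le_two
          (Finset.card_le_card (Finset.inter_subset_inter_left (Finset.erase_subset v U)))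
  rw [PMF.mean_sub, PMF.mean_sub, PMF.mean_sub, PMF.mean_const] at h5
  linarith

/-- A good set has few vertices in each hyperedge. -/
theorem Good.sq_card_inter_le {H : FinHypergraph n M} {m : ℕ} {κ : ℝ} {f : Fin M} {z : Fin n → ℝ}
    {U : Finset (Fin n)} {v : Fin n} (h : H.Good m κ f z (U.erase v)) (hm : 0 < m) (hn : 0 < n)
    (e : Fin M) :
    ((H.edge e ∩ U).card : ℝ) ^ 2 ≤ 64 * (1 + Real.log (n * m)) ^ 2 := by
  have hm1 : (1 : ℝ) ≤ m := by exact_mod_cast hm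
  have hn1 : (1 : ℝ) ≤ n := by exact_mod_cast hn
  have hlog : Real.log m ≤ Real.log (n * m) := Real.log_le_log (by linarith) (by nlinarith)
  have hlog0 : 0 ≤ Real.log m := Real.log_nonneg hm1
  set c := (H.edge e ∩ U.erase v).card with hc
  have h1 : (2 : ℝ) ^ c ≤ 128 * m :=
    (Finset.single_le_sum (f := fun e => (2 : ℝ) ^ (H.edge e ∩ U.erase v).card)
      (fun e _ => by positivity) (Finset.mem_univ e)).trans h.2.2
  have h2 : c * Real.log 2 ≤ 7 * Real.log 2 + Real.log m := by
    have := Real.log_le_log (by positivity) h1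
    rwa [Real.log_pow, Real.log_mul (by norm_num) (by linarith),
      show (128 : ℝ) = 2 ^ 7 by norm_num, Real.log_pow] at this
  have h3 : (1 / 2 : ℝ) ≤ Real.log 2 := by linarith [Real.log_two_gt_d9]
  have h4 : ((H.edge e ∩ U).card : ℝ) ≤ c + 1 := by
    have : (H.edge e ∩ U).card ≤ c + 1 := by
      rw [hc, Finset.inter_erase]
      exact Nat.sub_le_iff_le_add.1 Finset.pred_card_le_card_erase
    exact_mod_cast this
  have h5 : (c : ℝ) ≤ 7 + 2 * Real.log m := by
    by_contra! h6
    nlinarith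
  have h6 : ((H.edge e ∩ U).card : ℝ) ≤ 8 * (1 + Real.log (n * m)) := by linarith
  calc ((H.edge e ∩ U).card : ℝ) ^ 2 ≤ (8 * (1 + Real.log (n * m))) ^ 2 :=
        pow_le_pow_left₀ (Nat.cast_nonneg _) h6 2
    _ = _ := by ring

end FinHypergraph

/-! ### The potential function -/

namespace FinHypergraph

variable {n M : ℕ}

/-- The number of indices `i` whose hyperedge `f i` is not in `D`, plus `c` times the total energy
of the hyperedges not in `D`. -/
noncomputable def progress {k : ℕ} (f : Fin k → Fin M) (E : Fin M → ℝ) (c : ℝ)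
    (D : Finset (Fin M)) : ℝ :=
  ∑ i, (if f i ∈ D then 0 else 1) + c * ∑ e, E e * if e ∈ D then 0 else 1

theorem mean_notMem_union (G : LabelledMultigraph n M) (lam : ℝ) (D : Finset (Fin M)) (e : Fin M) :
    (independentSubset G fun t => ENNReal.ofReal lam * G.effResistance t.2.1 t.2.2).mean
        (fun T => if e ∈ D ∪ T.image Prod.fst then 0 else 1) =
      (if e ∈ D then 0 else 1) - (if e ∉ D then G.recoverProb lam e else 0) := by
  by_cases h : e ∈ D
  · simp [h, PMF.mean_const]
  · rw [if_neg h, if_pos h, LabelledMultigraph.recoverProb, eq_sub_iff_add_eq, ← PMF.mean_add]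
    refine Eq.trans (congrArg _ (funext fun T => ?_)) (PMF.mean_const _ 1)
    by_cases h2 : e ∈ T.image Prod.fst
    · rw [if_pos (Finset.mem_union_right _ h2), if_pos h2, zero_add]
    · rw [if_neg fun h3 => (Finset.mem_union.1 h3).elim h h2, if_neg h2, add_zero]

theorem mean_progress_union {k : ℕ} (f : Fin k → Fin M) (E : Fin M → ℝ) (c : ℝ)
    (G : LabelledMultigraph n M) (lam : ℝ) (D : Finset (Fin M)) :
    (independentSubset G fun t => ENNReal.ofReal lam * G.effResistance t.2.1 t.2.2).mean
        (fun T => progress f E c (D ∪ T.image Prod.fst)) =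
      progress f E c D - (∑ i ∈ Finset.univ.filter (fun i => f i ∉ D), G.recoverProb lam (f i) +
        c * ∑ e ∈ Dᶜ, E e * G.recoverProb lam e) := by
  have hD : Dᶜ = Finset.univ.filter fun e => e ∉ D := by ext; simp
  simp only [progress, PMF.mean_add, PMF.mean_sum, PMF.mean_mul_left, mean_notMem_union, mul_sub,
    Finset.sum_sub_distrib]
  rw [hD, Finset.sum_filter, Finset.sum_filter]
  simp only [mul_ite, mul_zero]
  ring

/-- In expectation, a round decreases the potential function by the rate at which the anchors of the
unrecovered hyperedges are kept together with a good set. -/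
theorem mean_vsRound_progress_le (H : FinHypergraph n M) {k : ℕ} {z : Fin k → Fin n → ℝ}
    {v : Fin k → Fin n} {f : Fin k → Fin M} {E : Fin M → ℝ} (hE0 : ∀ e, 0 ≤ E e)
    (hE : ∀ e, ∀ u ∈ H.edge e, ∀ w ∈ H.edge e, ∑ i, (z i u - z i w) ^ 2 ≤ E e)
    (hz : ∀ i, z i (v i) = 1) (hv : ∀ i, v i ∈ H.edge (f i))
    {r m : ℕ} (hr : 0 < r) (hm : 0 < m) {κ lam : ℝ} (hκ : 0 < κ) (hlam : 32 * κ ≤ lam)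
    (D : Finset (Fin M)) :
    (H.vsRound r lam D).mean
        (progress f E (32 * (64 * (1 + Real.log (n * m)) ^ 2) / lam)) ≤
      progress f E (32 * (64 * (1 + Real.log (n * m)) ^ 2) / lam) D -
        ∑ i, (H.goodProb r m κ (f i) (z i) (v i) / r) * if f i ∈ D then 0 else 1 := by
  classical
  set c := 32 * (64 * (1 + Real.log (n * m)) ^ 2) / lam with hc
  rw [mean_vsRound]
  simp only [mean_progress_union, ← mean_keptLaw_mem_good H hr]
  rw [PMF.mean_sub, PMF.mean_const]
  refine sub_le_sub_left ?_ _
  have h1 : ∀ i, (keptLaw n r).mean (fun U =>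
      if v i ∈ U ∧ H.Good m κ (f i) (z i) (U.erase (v i)) then 1 else 0) *
        (if f i ∈ D then 0 else 1) = (keptLaw n r).mean fun U => (if f i ∈ D then 0 else 1) *
      if v i ∈ U ∧ H.Good m κ (f i) (z i) (U.erase (v i)) then 1 else 0 := fun i => by
    rw [PMF.mean_mul_left, mul_comm]
  simp only [h1, ← PMF.mean_sum]
  refine PMF.mean_mono _ fun U => ?_
  set J : Finset (Fin k) := Finset.univ.filter fun i =>
    f i ∉ D ∧ v i ∈ U ∧ H.Good m κ (f i) (z i) (U.erase (v i)) with hJ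
  have h2 : ∑ i, (if f i ∈ D then (0 : ℝ) else 1) *
      (if v i ∈ U ∧ H.Good m κ (f i) (z i) (U.erase (v i)) then 1 else 0) = J.card := by
    rw [hJ, Finset.card_filter, Nat.cast_sum]
    refine Finset.sum_congr rfl fun i _ => ?_
    by_cases h3 : f i ∈ D
    · simp [h3]
    · by_cases h4 : v i ∈ U ∧ H.Good m κ (f i) (z i) (U.erase (v i))
      · simp [h3, h4]
      · simp only [h3, h4, and_false, if_false, mul_zero, Nat.cast_zero]
  rw [h2]
  have hmem : ∀ i ∈ J, f i ∉ D ∧ v i ∈ U ∧ H.Good m κ (f i) (z i) (U.erase (v i)) :=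
    fun i hi => (Finset.mem_filter.1 hi).2
  refine H.card_le_recoverProb_add_energy hE0 hE hκ hlam (by positivity) D U
    (fun i hi => (hmem i hi).1) (fun i _ => hz i)
    (fun i hi => Finset.mem_inter.2 ⟨hv i, (hmem i hi).2.1⟩) (fun i hi => ?_) (fun i hi => ?_) ?_
  · obtain ⟨w, hw, hwz⟩ := (hmem i hi).2.2.1
    exact ⟨w, Finset.inter_subset_inter_left (Finset.erase_subset _ _) hw, hwz⟩
  · exact (H.energy_deleteVertex_le_inducedEnergy U Dᶜ (v i) (z i)).trans (hmem i hi).2.2.2.1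
  · rintro ⟨i, hi⟩ e
    exact (hmem i hi).2.2.sq_card_inter_le hm (Fin.pos (v i)) e

/-- Within `20 r` rounds, some `f i` is recovered with probability at least `1 / 2`; otherwise the
potential function would become negative. -/
theorem exists_missProb_le_half (H : FinHypergraph n M) {k : ℕ} {z : Fin k → Fin n → ℝ}
    {v : Fin k → Fin n} {f : Fin k → Fin M} {E : Fin M → ℝ} (hE0 : ∀ e, 0 ≤ E e)
    (hE : ∀ e, ∀ u ∈ H.edge e, ∀ w ∈ H.edge e, ∑ i, (z i u - z i w) ^ 2 ≤ E e)
    (hz : ∀ i, z i (v i) = 1) (hv : ∀ i, v i ∈ H.edge (f i))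
    {r m : ℕ} (hk : 0 < k) (hr : 0 < r) (hm : 0 < m) (hMm : M ≤ m)
    (hcard : ∀ e, (H.edge e).card ≤ 2 * r)
    (hlow : ∀ i, (r : ℝ) / 2 ≤ ((H.edge (f i)).filter fun w => z i w ≤ 1 / 2).card)
    {L lam : ℝ} (hL : 0 < L) (hEL : ∑ e, E e ≤ k * L)
    (hlam : 4096 * L * (1 + Real.log (n * m)) ^ 2 ≤ lam) :
    ∃ i, H.missProb r lam (f i) (20 * r) ∅ ≤ 1 / 2 := by
  by_contra! hcon
  have hr' : (0 : ℝ) < r := by exact_mod_cast hr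
  have hk' : (0 : ℝ) < k := by exact_mod_cast hk
  have hn : 0 < n := Fin.pos (v ⟨0, hk⟩)
  have hlog : 0 ≤ Real.log (n * m) := by
    exact_mod_cast Real.log_natCast_nonneg (n * m)
  have hl1 : 1 ≤ (1 + Real.log (n * m)) ^ 2 := one_le_pow₀ (by linarith)
  have hlam1 : 32 * (64 * L) ≤ lam := by nlinarith
  have hlam0 : 0 < lam := by linarith
  set c := 32 * (64 * (1 + Real.log (n * m)) ^ 2) / lam with hc
  have hc0 : 0 ≤ c := by positivity
  have hcL : c * L ≤ 1 / 2 := by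
    rw [hc, div_mul_eq_mul_div, div_le_iff₀ hlam0]
    linarith
  set ρ : Fin k → ℝ := fun i =>
    LabelledMultigraph.energy (H.multigraph Finset.univ) (z i) / (r : ℝ) ^ 2 with hρ
  have hρ0 : ∀ i, 0 ≤ ρ i := fun i => div_nonneg (LabelledMultigraph.energy_nonneg _ _) (by positivity)
  have hρsum : ∑ i, ρ i ≤ 4 * (k * L) := by
    rw [hρ, ← Finset.sum_div, div_le_iff₀ (by positivity)]
    simp only [LabelledMultigraph.energy]
    rw [Finset.sum_comm]
    calc ∑ t ∈ H.multigraph Finset.univ, ∑ i, (z i t.2.1 - z i t.2.2) ^ 2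
        ≤ ∑ t ∈ H.multigraph Finset.univ, E t.1 := by
          refine Finset.sum_le_sum fun t ht => ?_
          have ht' := (Finset.mem_filter.1 ht).2
          exact hE _ _ ht'.2.1 _ ht'.2.2.1
      _ ≤ ∑ e, ((H.edge e).card : ℝ) ^ 2 * E e := H.sum_multigraph_le _ hE0
      _ ≤ ∑ e, (2 * r : ℝ) ^ 2 * E e := by
          refine Finset.sum_le_sum fun e _ => mul_le_mul_of_nonneg_right ?_ (hE0 e)
          exact pow_le_pow_left₀ (Nat.cast_nonneg _) (by exact_mod_cast hcard e) 2
      _ = (2 * r : ℝ) ^ 2 * ∑ e, E e := Finset.mul_sum _ _ _ |>.symm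
      _ ≤ (2 * r : ℝ) ^ 2 * (k * L) := mul_le_mul_of_nonneg_left hEL (by positivity)
      _ = _ := by ring
  -- With `κ = 64 * L`, the energy terms of `le_goodProb` add up to at most `k / 16`, while each miss
  -- probability exceeds `1 / 2`.
  have hdec : ∀ t ≤ 20 * r, 3 / 32 * k ≤
      ∑ i, H.goodProb r m (64 * L) (f i) (z i) (v i) * H.missProb r lam (f i) t ∅ := by
    intro t ht
    calc 3 / 32 * (k : ℝ) ≤ 5 / 32 * k - (∑ i, ρ i) / (64 * L) := by
          have : (∑ i, ρ i) / (64 * L) ≤ 2 / 32 * k := by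
            rw [div_le_iff₀ (by positivity)]
            linarith
          linarith
      _ = ∑ i, (5 / 32 - ρ i / (64 * L)) := by
          rw [Finset.sum_sub_distrib, Finset.sum_const, Finset.card_univ, Fintype.card_fin,
            nsmul_eq_mul, Finset.sum_div, mul_comm]
      _ ≤ _ := by
          refine Finset.sum_le_sum fun i _ => ?_
          have h1 := H.le_goodProb hr hMm hm hcard (κ := 64 * L) (by positivity) (hz i) (hlow i)
          have h2 := (hcon i).le.trans (H.missProb_mono_rounds r lam (f i) ht)
          have h3 := H.missProb_le_one r lam (f i) t
          have h4 : 0 ≤ ρ i / (64 * L) := div_nonneg (hρ0 i) (by positivity)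
          calc 5 / 32 - ρ i / (64 * L) ≤
                (5 / 16 - ρ i / (64 * L)) * H.missProb r lam (f i) t ∅ := by nlinarith
            _ ≤ _ := mul_le_mul_of_nonneg_right h1 (by linarith)
  have hstep : ∀ t ≤ 20 * r, (H.vs r lam (t + 1)).mean (progress f E c) ≤
      (H.vs r lam t).mean (progress f E c) - 3 / 32 * k / r := by
    intro t ht
    rw [show H.vs r lam (t + 1) = (H.vs r lam t).bind (H.vsRound r lam) from rfl, PMF.mean_bind]
    refine (PMF.mean_mono _ fun D =>
      H.mean_vsRound_progress_le hE0 hE hz hv hr hm (κ := 64 * L) (by positivity) hlam1 D).trans ?_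
    have hsum : ∑ i, (H.vs r lam t).mean (fun D =>
        (H.goodProb r m (64 * L) (f i) (z i) (v i) / r) * if f i ∈ D then 0 else 1) =
          (∑ i, H.goodProb r m (64 * L) (f i) (z i) (v i) * H.missProb r lam (f i) t ∅) / r := by
      rw [Finset.sum_div]
      refine Finset.sum_congr rfl fun i _ => ?_
      rw [PMF.mean_mul_left, mean_vs_notMem, div_mul_eq_mul_div]
    rw [PMF.mean_sub, PMF.mean_sum, hsum]
    exact sub_le_sub_left (div_le_div_of_nonneg_right (hdec t ht) hr'.le) _
  have hind : ∀ t ≤ 20 * r, (H.vs r lam t).mean (progress f E c) ≤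
      3 / 2 * k - t * (3 / 32 * k / r) := by
    intro t
    induction t with
    | zero =>
      intro _
      rw [show H.vs r lam 0 = PMF.pure ∅ from rfl, PMF.mean_pure, progress]
      simp only [Finset.notMem_empty, if_false, mul_one, Finset.sum_const, Finset.card_univ,
        Fintype.card_fin, nsmul_eq_mul, Nat.cast_zero, zero_mul, sub_zero]
      have := mul_le_mul_of_nonneg_left hEL hc0
      nlinarith
    | succ t ih =>
      intro ht
      have h1 := hstep t (by omega)
      have h2 := ih (by omega)
      push_cast
      linarith
  have hfin := hind (20 * r) le_rfl
  have h0 : 0 ≤ (H.vs r lam (20 * r)).mean (progress f E c) := by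
    refine PMF.mean_nonneg _ fun D => add_nonneg (Finset.sum_nonneg fun i _ => ?_)
      (mul_nonneg hc0 (Finset.sum_nonneg fun e _ => mul_nonneg (hE0 e) ?_))
    · split_ifs <;> norm_num
    · split_ifs <;> norm_num
  have h1 : ((20 * r : ℕ) : ℝ) * (3 / 32 * k / r) = 60 / 32 * k := by
    push_cast
    field_simp
    norm_num
  rw [h1] at hfin
  linarith

/-! ### Anchors -/

/-- A spanned vector has, up to exchanging `0` and `1`, an anchor of potential `1` in the hyperedge
such that at least `r / 2` of its vertices have potential at most `1 / 2`. -/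
theorem Spans.exists_anchor {H : FinHypergraph n M} {f : Fin M} {x : Fin n → ℝ}
    (h : H.Spans f x) {r : ℕ} (hr : r ≤ (H.edge f).card) :
    ∃ z : Fin n → ℝ, ∃ v ∈ H.edge f, z v = 1 ∧
      (r : ℝ) / 2 ≤ ((H.edge f).filter fun w => z w ≤ 1 / 2).card ∧
      ∀ u w, (z u - z w) ^ 2 = (x u - x w) ^ 2 := by
  obtain ⟨u, hu, w, hw, hxu, hxw⟩ := h
  have hr' : (r : ℝ) ≤ (H.edge f).card := by exact_mod_cast hr
  have hsum : (((H.edge f).filter fun w => x w ≤ 1 / 2).card : ℝ) +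
      ((H.edge f).filter fun w => ¬ x w ≤ 1 / 2).card = (H.edge f).card := by
    exact_mod_cast Finset.card_filter_add_card_filter_not _
  by_cases hc : (r : ℝ) / 2 ≤ ((H.edge f).filter fun w => x w ≤ 1 / 2).card
  · exact ⟨x, u, hu, hxu, hc, fun _ _ => rfl⟩
  · refine ⟨fun a => 1 - x a, w, hw, by simp [hxw], ?_, fun a b => by ring⟩
    have hsub : (((H.edge f).filter fun w => ¬ x w ≤ 1 / 2).card : ℝ) ≤
        ((H.edge f).filter fun w => 1 - x w ≤ 1 / 2).card := by
      refine Nat.cast_le.2 (Finset.card_le_card fun a ha => ?_)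
      obtain ⟨h1, h2⟩ := Finset.mem_filter.1 ha
      exact Finset.mem_filter.2 ⟨h1, by linarith⟩
    push Not at hc
    linarith

end FinHypergraph

theorem mainTheorem8 (A : ℝ) (a : ℕ) (P : ℝ) (hP : 0 < P) (p d : ℕ) :
    ∃ (B : ℝ) (b : ℕ) (C : ℝ) (c : ℕ), 1 ≤ B ∧ 1 ≤ C ∧
      ∀ (n m M r : ℕ) (H : FinHypergraph n M) (F : Finset (Fin M)) (θ : ℝ)
        (k : ℕ) (x : Fin k → Fin n → ℝ),
        M ≤ m → 0 < r → (∀ e, r ≤ (H.edge e).card ∧ (H.edge e).card ≤ 2 * r) →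
        0 < θ → θ < 1 → 1 / (P * (n : ℝ) ^ p) ≤ θ →
        0 < k → (∀ i u, x i u ∈ Set.Icc (0 : ℝ) 1) →
        (∀ i, ∃ f ∈ F, H.Spans f (x i)) →
        H.collectiveEnergy x ≤ k * polylog A a n m / θ →
        ∃ f ∈ F, (∃ i, H.Spans f (x i)) ∧
          1 - 1 / ((n : ℝ) * m) ^ d ≤
            ((H.vs r (polylog B b n m / θ) (r * ⌈polylog C c n m⌉₊)).toOuterMeasure
              {S | f ∈ S}).toReal := by
  -- `A` may be nonpositive, so the rate is chosen in terms of `max A 1`. Two extra logarithmic factors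
  -- account for the number of multi-edges that a hyperedge may have in a round.
  have hA1 : 1 ≤ max A 1 := le_max_right _ _
  have hd : (0 : ℝ) ≤ d := Nat.cast_nonneg d
  refine ⟨4096 * max A 1, a + 2, 20 * (2 * d + 1), 1, by linarith, by linarith, ?_⟩
  intro n m M r H F θ k x hMm hr hcard hθ _ _ hk _ hspan hen
  choose f hfF hfx using hspan
  choose z v hvf hzv hlow hsq using fun i => (hfx i).exists_anchor (hcard (f i)).1
  set i₀ : Fin k := ⟨0, hk⟩ with hi₀
  have hn : 0 < n := Fin.pos (v i₀)
  have hm : 0 < m := (Fin.pos (f i₀)).trans_le hMm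
  have hnm : (0 : ℝ) < (n : ℝ) * m := by positivity
  have hlog : 0 ≤ Real.log (n * m) := by exact_mod_cast Real.log_natCast_nonneg (n * m)
  set E : Fin M → ℝ := fun e => ⨆ p : {a // a ∈ H.edge e} × {a // a ∈ H.edge e},
    ∑ i : Fin k, (x i p.1 - x i p.2) ^ 2 with hEdef
  have hE0 : ∀ e, 0 ≤ E e := fun e =>
    Real.iSup_nonneg fun _ => Finset.sum_nonneg fun _ _ => sq_nonneg _
  have hE : ∀ e, ∀ u ∈ H.edge e, ∀ w ∈ H.edge e, ∑ i, (z i u - z i w) ^ 2 ≤ E e := by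
    intro e u hu w hw
    simp only [hsq]
    exact le_ciSup (f := fun p : {a // a ∈ H.edge e} × {a // a ∈ H.edge e} =>
      ∑ i : Fin k, (x i p.1 - x i p.2) ^ 2) (Set.finite_range _).bddAbove (⟨u, hu⟩, ⟨w, hw⟩)
  set L : ℝ := polylog (max A 1) a n m / θ with hL
  have hL0 : 0 < L := by
    rw [hL, polylog]
    positivity
  have hEL : ∑ e, E e ≤ k * L := by
    refine hen.trans ?_
    rw [hL, mul_div_assoc, polylog, polylog]
    gcongr
    exact le_max_left _ _
  have hlam : 4096 * L * (1 + Real.log (n * m)) ^ 2 ≤ polylog (4096 * max A 1) (a + 2) n m / θ := by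
    refine le_of_eq ?_
    rw [hL, polylog, polylog]
    ring
  obtain ⟨i, hi⟩ := H.exists_missProb_le_half hE0 hE hzv hvf hk hr hm hMm (fun e => (hcard e).2)
    hlow hL0 hEL hlam
  refine ⟨f i, hfF i, ⟨i, hfx i⟩, ?_⟩
  rw [FinHypergraph.toReal_vs_mem]
  refine sub_le_sub_left ?_ 1
  set N := ⌈polylog (20 * (2 * d + 1)) 1 n m⌉₊ with hN
  -- Split the rounds into `N / 20` blocks of `20 r` rounds.
  have hj : 2 * d * Real.log (n * m) ≤ (N / 20 : ℕ) := by
    have h1 : 20 * (2 * d + 1) * (1 + Real.log (n * m)) ^ 1 ≤ (N : ℝ) := Nat.le_ceil _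
    have h2 : (N : ℝ) ≤ 20 * (N / 20 : ℕ) + 20 := by
      have : N ≤ 20 * (N / 20) + 20 := by omega
      exact_mod_cast this
    rw [pow_one] at h1
    nlinarith
  have hle : 20 * r * (N / 20) ≤ r * N := by
    calc 20 * r * (N / 20) = r * (20 * (N / 20)) := by ring
      _ ≤ r * N := Nat.mul_le_mul_left r (Nat.mul_div_le N 20)
  set lam := polylog (4096 * max A 1) (a + 2) n m / θ
  calc H.missProb r lam (f i) (r * N) ∅ ≤ H.missProb r lam (f i) (20 * r * (N / 20)) ∅ :=
        H.missProb_mono_rounds r lam (f i) hle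
    _ ≤ H.missProb r lam (f i) (20 * r) ∅ ^ (N / 20) := H.missProb_mul_le_pow r lam (f i) _ _
    _ ≤ (1 / 2) ^ (N / 20) := pow_le_pow_left₀ (H.missProb_nonneg r lam (f i) _ _) hi _
    _ = Real.exp (-((N / 20 : ℕ) * Real.log 2)) := by
        rw [Real.exp_neg, Real.exp_nat_mul, Real.exp_log two_pos, one_div, inv_pow]
    _ ≤ Real.exp (-(d * Real.log (n * m))) := by
        rw [Real.exp_le_exp, neg_le_neg_iff]
        have h3 : (1 / 2 : ℝ) ≤ Real.log 2 := by linarith [Real.log_two_gt_d9]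
        nlinarith
    _ = 1 / ((n : ℝ) * m) ^ d := by
        rw [Real.exp_neg, Real.exp_nat_mul, Real.exp_log hnm, one_div]
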